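/- Let $N\in\mathbb N$, $T>0$, $\alpha\in(0,1)$, and let $H:\mathbb R^N\times\mathbb R^N\to\mathbb R$ be continuous and $u_0:\mathbb R^N\to\mathbb R$. Assume (A1) $\lim_{r\to\infty}\inf\{H(y,p) : y\in\mathbb R^N,\ |p|\ge r\}=\infty$; (A2) $H(y+k,p)=H(y,p)$ for all $y,p\in\mathbb R^N$, $k\in\mathbb Z^N$; (A3) $u_0$ is Lipschitz continuous, bounded and uniformly continuous on $\mathbb R^N$. For $\varepsilon>0$ consider the problem $$\partial_t^\alpha u^\varepsilon+H\Big(\frac x\varepsilon,Du^\varepsilon\Big)=0\ \text{ in }\mathbb R^N\times(0,T),\qquad u^\varepsilon(\cdot,0)=u_0\ \text{ on }\mathbb R^N,\tag{1}$$ where $\partial^\alpha_t$ is the Caputo derivative, understood through $\partial_t^\alpha f(t)=J[f](t)+K[f](t)$ with $$J[f](t)=\frac{f(t)-f(0)}{t^\alpha\,\Gamma(1-\alpha)},\qquad K[f](t)=\frac{\alpha}{\Gamma(1-\alpha)}\int_0^t\frac{f(t)-f(t-\tau)}{\tau^{\alpha+1}}\,d\tau .$$ A function $u\in C(\mathbb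 R^N\times[0,T])$ is a viscosity solution of (1) if $u(\cdot,0)=u_0$ and, for every $\varphi\in C^1(\mathbb R^N\times(0,T])\cap C(\mathbb R^N\times[0,T])$ and every $(\hat x,\hat t)\in\mathbb R^N\times(0,T]$, the quantity $$J[\varphi(\hat x,\cdot)](\hat t)+K[\varphi(\hat x,\cdot)](\hat t)+H\Big(\frac{\hat x}{\varepsilon},D\varphi(\hat x,\hat t)\Big)$$ is $\le 0$ if $u-\varphi$ attains its maximum over $\mathbb R^N\times[0,T]$ at $(\hat x,\hat t)$, and is $\ge 0$ if $u-\varphi$ attains its minimum over $\mathbb R^N\times[0,T]$ at $(\hat x,\hat t)$. Below, $u^\varepsilon$ denotes any bounded viscosity solution of (1). (i) There is a modulus of continuity $\omega\in C([0,\infty))$ (continuous, nondecreasing, $\omega(0)=0$), independent of $\varepsilon$, such that for all $\varepsilon>0$ $$|u^\varepsilon(x,t)-u^\varepsilon(y,t)|\le\omega(|x-y|)\qquad\text{for all }x,y\in\mathbb R^N,\ t\in[0,T].$$ (ii) Assume in addition (A5): there is $C_0>0$ such that $H(x,p)\ge C_0^{-1}|p|-C_0$ for all $x,p\in\mathbb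 R^N$. Then there is a constant $C>0$, independent of $\varepsilon$, such that for all $\varepsilon>0$ $$|u^\varepsilon(x,t)-u^\varepsilon(y,t)|\le C\big(1+\big|\log|x-y|\big|\big)|x-y|\qquad\text{for all }x,y\in\mathbb R^N,\ t\in[0,T],$$ where the right-hand side is read as $0$ if $x=y$. In particular, for each $\nu\in(0,1)$ there is a constant $C>0$, independent of $\varepsilon$, such that for all $\varepsilon>0$ $$|u^\varepsilon(x,t)-u^\varepsilon(y,t)|\le C|x-y|^\nu\qquad\text{for all }x,y\in\mathbb R^N,\ t\in[0,T].$$ -/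

import Mathlib

open Set Filter Topology

namespace TFHJ

noncomputable section

/-- The space `ℝ^N` with its Euclidean norm. -/
abbrev Space (N : ℕ) : Type := EuclideanSpace ℝ (Fin N)

/-- The closed space-time domain `ℝ^N × [0, T]`. -/
def closedDomain (N : ℕ) (T : ℝ) : Set (Space N × ℝ) := univ ×ˢ Icc 0 T

/-- The domain `ℝ^N × (0, T]`, where the equation is tested. -/
def testDomain (N : ℕ) (T : ℝ) : Set (Space N × ℝ) := univ ×ˢ Ioc 0 T

/-- Coercivity, uniform in the first variable:
`lim_{r → ∞} inf {H(y, p) | y ∈ ℝ^N, |p| ≥ r} = ∞`. The infimum is taken in `[-∞, ∞]`. -/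
def Coercive {N : ℕ} (H : Space N → Space N → ℝ) : Prop :=
  Tendsto (fun r : ℝ => ⨅ (y : Space N) (p : Space N) (_ : r ≤ ‖p‖), (H y p : EReal))
    atTop (𝓝 ⊤)

/-- `ℤ^N`-periodicity in the first variable. -/
def Periodic {N : ℕ} (H : Space N → Space N → ℝ) : Prop :=
  ∀ (y p : Space N) (k : Fin N → ℤ), H (y + WithLp.toLp 2 (fun i => (k i : ℝ))) p = H y p

/-- `u₀ ∈ Lip(ℝ^N) ∩ BUC(ℝ^N)`. -/
def LipBUC {N : ℕ} (u₀ : Space N → ℝ) : Prop :=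
  (∃ K : NNReal, LipschitzWith K u₀) ∧ UniformContinuous u₀ ∧ ∃ B : ℝ, ∀ x, |u₀ x| ≤ B

/-- At least linear growth: `H(x, p) ≥ C⁻¹ |p| - C` for some `C > 0`. -/
def LinearGrowth {N : ℕ} (H : Space N → Space N → ℝ) : Prop :=
  ∃ C : ℝ, 0 < C ∧ ∀ x p : Space N, C⁻¹ * ‖p‖ - C ≤ H x p

/-- `J[f](t) = (f(t) - f(0)) / (t^α Γ(1 - α))`. -/
def caputoJ (α : ℝ) (f : ℝ → ℝ) (t : ℝ) : ℝ :=
  (f t - f 0) / (t ^ α * Real.Gamma (1 - α))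

/-- `K_{(a,b)}[f](t) = α / Γ(1 - α) ∫_a^b (f(t) - f(t - τ)) / τ^(α + 1) dτ`. -/
def caputoK (α a b : ℝ) (f : ℝ → ℝ) (t : ℝ) : ℝ :=
  α / Real.Gamma (1 - α) * ∫ τ in a..b, (f t - f (t - τ)) / τ ^ (α + 1)

/-- Test functions: `φ ∈ C¹(ℝ^N × (0, T]) ∩ C(ℝ^N × [0, T])`. -/
def IsTestFunction {N : ℕ} (T : ℝ) (φ : Space N → ℝ → ℝ) : Prop :=
  ContDiffOn ℝ 1 (Function.uncurry φ) (testDomain N T) ∧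
    ContinuousOn (Function.uncurry φ) (closedDomain N T)

/-- The left-hand side `J[φ] + K_{(0,t)}[φ] + H(x/ε, Dφ)` at `(x, t)`, with `D` the spatial
gradient. For a test function `φ`, `J[φ] + K_{(0,t)}[φ]` is the Caputo derivative of order `α`
of `φ(x, ·)` at `t`, and its integrand is integrable. -/
def operator {N : ℕ} (α ε : ℝ) (H : Space N → Space N → ℝ) (φ : Space N → ℝ → ℝ)
    (x : Space N) (t : ℝ) : ℝ :=
  caputoJ α (φ x) t + caputoK α 0 t (φ x) t + H (ε⁻¹ • x) (gradient (fun z => φ z t) x)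

/-- Viscosity subsolution of `∂_t^α u + H(x/ε, Du) = 0`, `u(·, 0) = u₀`. Only the values of `u`
on `ℝ^N × [0, T]` matter. -/
def IsSubsolution {N : ℕ} (T α ε : ℝ) (H : Space N → Space N → ℝ) (u₀ : Space N → ℝ)
    (u : Space N → ℝ → ℝ) : Prop :=
  UpperSemicontinuousOn (Function.uncurry u) (closedDomain N T) ∧
    (∀ x, u x 0 ≤ u₀ x) ∧
    ∀ φ : Space N → ℝ → ℝ, IsTestFunction T φ → ∀ (x : Space N) (t : ℝ), t ∈ Ioc 0 T →
      IsMaxOn (fun z : Space N × ℝ => u z.1 z.2 - φ z.1 z.2) (closedDomain N T) (x, t) →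
      operator α ε H φ x t ≤ 0

/-- Viscosity supersolution of `∂_t^α u + H(x/ε, Du) = 0`, `u(·, 0) = u₀`. -/
def IsSupersolution {N : ℕ} (T α ε : ℝ) (H : Space N → Space N → ℝ) (u₀ : Space N → ℝ)
    (u : Space N → ℝ → ℝ) : Prop :=
  LowerSemicontinuousOn (Function.uncurry u) (closedDomain N T) ∧
    (∀ x, u₀ x ≤ u x 0) ∧
    ∀ φ : Space N → ℝ → ℝ, IsTestFunction T φ → ∀ (x : Space N) (t : ℝ), t ∈ Ioc 0 T →
      IsMinOn (fun z : Space N × ℝ => u z.1 z.2 - φ z.1 z.2) (closedDomain N T) (x, t) →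
      0 ≤ operator α ε H φ x t

/-- Viscosity solution: continuous on `ℝ^N × [0, T]`, and both a sub- and a supersolution. -/
def IsViscositySolution {N : ℕ} (T α ε : ℝ) (H : Space N → Space N → ℝ) (u₀ : Space N → ℝ)
    (u : Space N → ℝ → ℝ) : Prop :=
  ContinuousOn (Function.uncurry u) (closedDomain N T) ∧
    IsSubsolution T α ε H u₀ u ∧ IsSupersolution T α ε H u₀ u

/-- Boundedness on `ℝ^N × [0, T]`; the bound may depend on `u`. -/
def IsBounded {N : ℕ} (T : ℝ) (u : Space N → ℝ → ℝ) : Prop :=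
  ∃ B : ℝ, ∀ (x : Space N), ∀ t ∈ Icc 0 T, |u x t| ≤ B

/-- Modulus of continuity `ω ∈ C([0, ∞))`: continuous, nondecreasing, `ω(0) = 0`
(so `ω ≥ 0`). -/
def IsModulus (ω : ℝ → ℝ) : Prop :=
  ContinuousOn ω (Ici 0) ∧ MonotoneOn ω (Ici 0) ∧ ω 0 = 0

end

end TFHJ

open Set Filter Topology MeasureTheory

namespace TFHJ

noncomputable section

variable {N : ℕ}

/-! In space, coercivity bounds the gradient of a test function as soon as the Caputo derivative of
its time part is bounded below. The natural time penalisation is `C|t - s|^α`, and it just fails: at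
`t = s` the singular integral diverges logarithmically. Replacing it by `C((t - s)² + η²)^(α/2)`
costs `C η^α` in the value and makes the Caputo derivative at least `-A(1 + log(1/η))`
(`caputo_ge_neg_log`). Coercivity then gives a radius `R(η)` and the estimate `|u(x,t) - u(y,t)| ≤
2R(η)|x - y| + C η^α` (`IsViscositySolution.space_modulus`), with all constants independent of `ε`.
The infimum over `η` of these affine functions of `|x - y|` is the modulus of (i). Under linear
growth `R(η)` is of order `1 + log(1/η)`, and `η^α = min(|x - y|, 1)` gives (ii).

The spatial estimate relies on the bound `|u(x,t) - u(x,s)| ≤ C|t - s|^α`, uniform in `ε`. At `s =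
0` it follows from the barriers `u₀ ± C t^α` (`IsSubsolution.initial_bound`). It propagates to all
times by doubling variables (`IsViscositySolution.time_holder`). There the equation must be used
with the past of `u` itself in place of that of the test function (`IsSubsolution.memory_le`), so
that the two histories can be compared at equal lags. The rapid oscillation of `H(x/ε, p)` does no
harm: for fixed `ε` the doubling parameter may depend on `ε`, and it disappears from the conclusion.
-/

/-! ### Uniformity of the Hamiltonian from periodicity and coercivity -/

theorem exists_intShift (x : Space N) :
    ∃ k : Fin N → ℤ, ‖x + WithLp.toLp 2 (fun i => (k i : ℝ))‖ ≤ √N := by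
  refine ⟨fun i => -⌊x i⌋, ?_⟩
  rw [EuclideanSpace.norm_eq]
  apply Real.sqrt_le_sqrt
  calc _ ≤ ∑ _i : Fin N, (1 : ℝ) := by
        apply Finset.sum_le_sum
        intro i _
        have h0 := Int.fract_nonneg (x i)
        have h1 := (Int.fract_lt_one (x i)).le
        have : (x + WithLp.toLp 2 (fun i => (((-⌊x i⌋ : ℤ)) : ℝ))) i = Int.fract (x i) := by
          simp [Int.fract, sub_eq_add_neg]
        rw [this, Real.norm_of_nonneg h0]
        nlinarith
    _ = N := by simp

theorem Periodic.exists_bound {H : Space N → Space N → ℝ} (hH : Continuous (Function.uncurry H))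
    (hP : Periodic H) (R : ℝ) : ∃ A : ℝ, 0 < A ∧ ∀ x p, ‖p‖ ≤ R → |H x p| ≤ A := by
  have hK : IsCompact (Metric.closedBall (0 : Space N) (√N) ×ˢ Metric.closedBall (0 : Space N) R) :=
    (isCompact_closedBall _ _).prod (isCompact_closedBall _ _)
  obtain ⟨A, hA⟩ := hK.exists_bound_of_continuousOn hH.continuousOn
  refine ⟨max A 1, by positivity, fun x p hp => ?_⟩
  obtain ⟨k, hk⟩ := exists_intShift x
  rw [← hP x p k]
  refine le_trans ?_ (le_max_left _ _)
  exact hA (_, p) ⟨by simpa using hk, by simpa using hp⟩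

theorem Periodic.uniform_continuity {H : Space N → Space N → ℝ}
    (hH : Continuous (Function.uncurry H)) (hP : Periodic H) (R : ℝ) {e : ℝ} (he : 0 < e) :
    ∃ d : ℝ, 0 < d ∧ ∀ x y p q, ‖p‖ ≤ R → ‖q‖ ≤ R → ‖x - y‖ < d → ‖p - q‖ < d →
      |H x p - H y q| < e := by
  have hK : IsCompact
      (Metric.closedBall (0 : Space N) (√N + 1) ×ˢ Metric.closedBall (0 : Space N) R) :=
    (isCompact_closedBall _ _).prod (isCompact_closedBall _ _)
  have hu := hK.uniformContinuousOn_of_continuous hH.continuousOn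
  rw [Metric.uniformContinuousOn_iff] at hu
  obtain ⟨d, hd, h⟩ := hu e he
  refine ⟨min d 1, by positivity, fun x y p q hp hq hxy hpq => ?_⟩
  obtain ⟨k, hk⟩ := exists_intShift x
  rw [← hP x p k, ← hP y q k]
  set v : Space N := WithLp.toLp 2 (fun i => (k i : ℝ))
  have hy : ‖y + v‖ ≤ √N + 1 := by
    have : y + v = (x + v) - (x - y) := by abel
    rw [this]
    have h1 := lt_of_lt_of_le hxy (min_le_right d 1)
    linarith [norm_sub_le (x + v) (x - y)]
  have := h (x + v, p) ⟨by simpa using hk.trans (by linarith), by simpa using hp⟩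
    (y + v, q) ⟨by simpa using hy, by simpa using hq⟩ (by
      rw [Prod.dist_eq, max_lt_iff, dist_eq_norm, dist_eq_norm]
      refine ⟨?_, lt_of_lt_of_le hpq (min_le_left _ _)⟩
      simpa using lt_of_lt_of_le hxy (min_le_left _ _))
  simpa [Real.dist_eq] using this

theorem Coercive.exists_radius {H : Space N → Space N → ℝ} (hC : Coercive H) (A : ℝ) :
    ∃ R : ℝ, ∀ y p, R ≤ ‖p‖ → A < H y p := by
  have h := (hC.eventually (lt_mem_nhds (EReal.coe_lt_top A))).exists
  obtain ⟨R, hR⟩ := h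
  refine ⟨R, fun y p hp => ?_⟩
  have : (A : EReal) < (H y p : EReal) :=
    lt_of_lt_of_le hR ((iInf_le _ y).trans ((iInf_le _ p).trans (iInf_le _ hp)))
  exact_mod_cast this

/-! ### Smoothed distance and gradients -/

/-- The smoothed distance `√(‖x - a‖² + σ²)`. -/
def smoothDist (σ : ℝ) (a x : Space N) : ℝ := √(‖x - a‖ ^ 2 + σ ^ 2)

theorem contDiff_smoothDist {σ : ℝ} (hσ : 0 < σ) (a : Space N) :
    ContDiff ℝ 1 (smoothDist σ a) := by
  unfold smoothDist
  apply ContDiff.sqrt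
  · exact ((contDiff_id.sub contDiff_const).norm_sq ℝ).add contDiff_const
  · intro x; positivity

theorem norm_le_smoothDist (σ : ℝ) (a x : Space N) : ‖x - a‖ ≤ smoothDist σ a x :=
  Real.le_sqrt_of_sq_le (by nlinarith [sq_nonneg σ])

theorem smoothDist_le {σ : ℝ} (hσ : 0 < σ) (a x : Space N) : smoothDist σ a x ≤ ‖x - a‖ + σ := by
  unfold smoothDist
  rw [Real.sqrt_le_left (by positivity)]
  nlinarith [norm_nonneg (x - a)]

theorem smoothDist_pos {σ : ℝ} (hσ : 0 < σ) (a x : Space N) : 0 < smoothDist σ a x :=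
  Real.sqrt_pos.2 (by positivity)

theorem hasGradientAt_add {f g : Space N → ℝ} {p q x : Space N} (hf : HasGradientAt f p x)
    (hg : HasGradientAt g q x) : HasGradientAt (fun z => f z + g z) (p + q) x := by
  rw [hasGradientAt_iff_hasFDerivAt, map_add]
  exact hf.hasFDerivAt.add hg.hasFDerivAt

theorem hasGradientAt_const_mul {f : Space N → ℝ} {p x : Space N} (hf : HasGradientAt f p x)
    (c : ℝ) : HasGradientAt (fun z => c * f z) (c • p) x := by
  rw [hasGradientAt_iff_hasFDerivAt, map_smul]
  exact hf.hasFDerivAt.const_mul c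

theorem hasGradientAt_norm_sq_sub (a x : Space N) :
    HasGradientAt (fun z : Space N => ‖z - a‖ ^ 2) ((2 : ℝ) • (x - a)) x := by
  rw [hasGradientAt_iff_hasFDerivAt]
  refine ((hasFDerivAt_id x).sub_const a).norm_sq.congr_fderiv ?_
  ext v
  simp [InnerProductSpace.toDual_apply_apply]

theorem hasGradientAt_smoothDist {σ : ℝ} (hσ : 0 < σ) (a x : Space N) :
    HasGradientAt (smoothDist σ a) ((smoothDist σ a x)⁻¹ • (x - a)) x := by
  rw [hasGradientAt_iff_hasFDerivAt]
  have h1 := (hasGradientAt_norm_sq_sub a x).hasFDerivAt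
  have h := (h1.add_const (σ ^ 2)).sqrt (by positivity)
  refine h.congr_fderiv ?_
  ext v
  simp only [smul_apply, InnerProductSpace.toDual_apply_apply,
    inner_smul_left, smoothDist, smul_eq_mul, RCLike.conj_to_real]
  field_simp

theorem norm_gradient_smoothDist_le {σ : ℝ} (hσ : 0 < σ) (a x : Space N) :
    ‖(smoothDist σ a x)⁻¹ • (x - a)‖ ≤ 1 := by
  have h := smoothDist_pos hσ a x
  rw [norm_smul, norm_inv, Real.norm_of_nonneg h.le, inv_mul_le_iff₀ h, mul_one]
  exact norm_le_smoothDist σ a x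

/-! ### The Caputo derivative as an integral over the whole past -/

/-- The part of the Caputo derivative that looks back further than `ρ`, for `f` extended to
negative times by `f 0`. -/
def memory (α ρ : ℝ) (f : ℝ → ℝ) (t : ℝ) : ℝ :=
  α / Real.Gamma (1 - α) * ∫ τ in Ioi ρ, (f t - f (max (t - τ) 0)) / τ ^ (α + 1)

theorem continuousOn_history {f : ℝ → ℝ} {t : ℝ} (ht : 0 ≤ t) (hf : ContinuousOn f (Icc 0 t)) :
    ContinuousOn (fun τ => f (max (t - τ) 0)) (Ici 0) := by
  apply hf.comp (by fun_prop)
  intro τ hτ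
  exact ⟨le_max_right _ _, max_le (by linarith [mem_Ici.1 hτ]) ht⟩

theorem continuousOn_memory_integrand {α : ℝ} {f : ℝ → ℝ} {t : ℝ} (ht : 0 ≤ t)
    (hf : ContinuousOn f (Icc 0 t)) :
    ContinuousOn (fun τ => (f t - f (max (t - τ) 0)) / τ ^ (α + 1)) (Ioi 0) := by
  apply ContinuousOn.div
  · exact continuousOn_const.sub ((continuousOn_history ht hf).mono Ioi_subset_Ici_self)
  · exact continuousOn_id.rpow_const (fun x hx => Or.inl (ne_of_gt hx))
  · intro x hx
    exact (Real.rpow_pos_of_pos hx _).ne'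

theorem integrableOn_memory {α : ℝ} (hα : 0 < α) {f : ℝ → ℝ} {t ρ : ℝ} (ht : 0 ≤ t) (hρ : 0 < ρ)
    (hf : ContinuousOn f (Icc 0 t)) :
    IntegrableOn (fun τ => (f t - f (max (t - τ) 0)) / τ ^ (α + 1)) (Ioi ρ) := by
  obtain ⟨B, hB⟩ := isCompact_Icc.exists_bound_of_continuousOn hf
  have hsub : Ioi ρ ⊆ Ioi 0 := Ioi_subset_Ioi hρ.le
  refine Integrable.mono'
    ((integrableOn_Ioi_rpow_of_lt (by linarith : -(α + 1) < -1) hρ).const_mul (2 * B))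
    (((continuousOn_memory_integrand ht hf).mono hsub).aestronglyMeasurable measurableSet_Ioi) ?_
  filter_upwards [ae_restrict_mem measurableSet_Ioi] with τ hτ
  have hτ0 : 0 < τ := hsub hτ
  have h1 := hB t ⟨ht, le_rfl⟩
  have h2 := hB (max (t - τ) 0) ⟨le_max_right _ _, max_le (by linarith) ht⟩
  rw [norm_div, Real.norm_of_nonneg (Real.rpow_nonneg hτ0.le _), Real.rpow_neg hτ0.le,
    div_eq_mul_inv]
  gcongr
  linarith [norm_sub_le (f t) (f (max (t - τ) 0))]

theorem div_rpow_add_one {τ : ℝ} (hτ : 0 < τ) (α G : ℝ) : G * τ / τ ^ (α + 1) = G * τ ^ (-α) := by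
  rw [Real.rpow_add_one hτ.ne', Real.rpow_neg hτ.le]
  have := (Real.rpow_pos_of_pos hτ α).ne'
  field_simp

theorem integrableOn_memory_zero {α : ℝ} (hα : 0 < α) (hα₁ : α < 1) {f : ℝ → ℝ} {t G : ℝ}
    (ht : 0 ≤ t) (hf : ContinuousOn f (Icc 0 t))
    (hG : ∀ s ∈ Icc 0 t, |f t - f s| ≤ G * (t - s)) (hG0 : 0 ≤ G) :
    IntegrableOn (fun τ => (f t - f (max (t - τ) 0)) / τ ^ (α + 1)) (Ioi 0) := by
  rw [← Ioc_union_Ioi_eq_Ioi zero_le_one]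
  refine IntegrableOn.union ?_ (integrableOn_memory hα ht one_pos hf)
  have hb : IntegrableOn (fun τ : ℝ => τ ^ (-α)) (Ioc 0 1) := by
    rw [← intervalIntegrable_iff_integrableOn_Ioc_of_le zero_le_one]
    exact intervalIntegral.intervalIntegrable_rpow' (by linarith)
  refine Integrable.mono' (hb.const_mul G)
    (((continuousOn_memory_integrand ht hf).mono Ioc_subset_Ioi_self).aestronglyMeasurable
      measurableSet_Ioc) ?_
  filter_upwards [ae_restrict_mem measurableSet_Ioc] with τ hτ
  have hτ0 : 0 < τ := hτ.1
  rw [norm_div, Real.norm_of_nonneg (Real.rpow_nonneg hτ0.le _), ← div_rpow_add_one hτ0]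
  gcongr
  refine (hG _ ⟨le_max_right _ _, max_le (by linarith) ht⟩).trans ?_
  gcongr
  linarith [le_max_left (t - τ) 0]

theorem integral_Ioi_rpow_memory {α t : ℝ} (hα : 0 < α) (ht : 0 < t) :
    ∫ τ in Ioi t, τ ^ (-(α + 1)) = t ^ (-α) / α := by
  rw [integral_Ioi_rpow_of_lt (by linarith) ht]
  have : -(α + 1) + 1 = -α := by ring
  rw [this]
  field_simp

/-- For lags beyond `t` the extended function is frozen at `f 0`, and the integral of `τ^(-α-1)`
over `(t, ∞)` is `t^(-α)/α`; this tail is exactly the term `J`. -/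
theorem caputo_eq_memory {α : ℝ} (hα : 0 < α) {f : ℝ → ℝ} {t : ℝ} (ht : 0 < t)
    (hint : IntegrableOn (fun τ => (f t - f (max (t - τ) 0)) / τ ^ (α + 1)) (Ioi 0)) :
    caputoJ α f t + caputoK α 0 t f t = memory α 0 f t := by
  unfold caputoJ caputoK memory
  rw [← Ioc_union_Ioi_eq_Ioi ht.le] at hint ⊢
  have hd : Disjoint (Ioc 0 t) (Ioi t) := by
    rw [Set.disjoint_left]; intro x hx hx'; exact absurd hx.2 (not_le.2 hx')
  rw [setIntegral_union hd measurableSet_Ioi hint.left_of_union hint.right_of_union,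
    intervalIntegral.integral_of_le ht.le]
  have e1 : ∫ τ in Ioc 0 t, (f t - f (max (t - τ) 0)) / τ ^ (α + 1)
      = ∫ τ in Ioc 0 t, (f t - f (t - τ)) / τ ^ (α + 1) := by
    apply setIntegral_congr_fun measurableSet_Ioc
    intro τ hτ
    simp only
    rw [max_eq_left (by linarith [hτ.2])]
  have e2 : ∫ τ in Ioi t, (f t - f (max (t - τ) 0)) / τ ^ (α + 1)
      = (f t - f 0) * (t ^ (-α) / α) := by
    rw [← integral_Ioi_rpow_memory hα ht, ← integral_const_mul]
    apply setIntegral_congr_fun measurableSet_Ioi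
    intro τ hτ
    have hτ' : t < τ := hτ
    simp only
    rw [max_eq_right (by linarith), Real.rpow_neg (by linarith), div_eq_mul_inv]
  rw [e1, e2, Real.rpow_neg ht.le]
  have := (Real.rpow_pos_of_pos ht α).ne'
  field_simp
  ring

theorem gammaFactor_pos {α : ℝ} (hα : 0 < α) (hα₁ : α < 1) : 0 < α / Real.Gamma (1 - α) :=
  div_pos hα (Real.Gamma_pos_of_pos (by linarith))

theorem integrableOn_Ioc_rpow {α : ℝ} (hα₁ : α < 1) {ρ : ℝ} (hρ : 0 ≤ ρ) :
    IntegrableOn (fun τ : ℝ => τ ^ (-α)) (Ioc 0 ρ) := by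
  rw [← intervalIntegrable_iff_integrableOn_Ioc_of_le hρ]
  exact intervalIntegral.intervalIntegrable_rpow' (by linarith)

theorem integral_Ioc_rpow {α : ℝ} (hα₁ : α < 1) {ρ : ℝ} (hρ : 0 ≤ ρ) :
    ∫ τ in Ioc 0 ρ, τ ^ (-α) = ρ ^ (1 - α) / (1 - α) := by
  rw [← intervalIntegral.integral_of_le hρ, integral_rpow (Or.inl (by linarith)),
    Real.zero_rpow (by linarith)]
  rw [show -α + 1 = 1 - α by ring, sub_zero]

/-- A lower bound for the Caputo derivative of a function which is `α`-Hölder continuous with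
constant `M` and Lipschitz continuous with constant `M η ^ (α - 1)`. -/
theorem caputo_ge_neg_log {α M T : ℝ} (hα : 0 < α) (hα₁ : α < 1) (hM : 0 < M) :
    ∃ A : ℝ, 0 < A ∧ ∀ (η : ℝ) (g : ℝ → ℝ) (t : ℝ), 0 < η → η ≤ 1 → t ∈ Ioc 0 T →
      ContinuousOn g (Icc 0 t) →
      (∀ s ∈ Icc 0 t, |g t - g s| ≤ M * η ^ (α - 1) * (t - s)) →
      (∀ s ∈ Icc 0 t, |g t - g s| ≤ M * (t - s) ^ α) →
      -(A * (1 + Real.log (1 / η))) ≤ caputoJ α g t + caputoK α 0 t g t := by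
  have hΓ := gammaFactor_pos hα hα₁
  -- The maximum with `1` guarantees both `η ≤ T'` and `log T' ≥ 0`.
  set T' := max T 1
  have hT1 : 1 ≤ T' := le_max_right _ _
  have hT'0 : 0 < T' := by linarith
  have hlog : 0 ≤ Real.log T' := Real.log_nonneg hT1
  have h1α : 0 < 1 - α := by linarith
  refine ⟨α / Real.Gamma (1 - α) * (M * (1 / (1 - α) + 1 / α + Real.log T' + 1)), by positivity,
    fun η g t hη hη1 ht hg hLip hHol => ?_⟩
  have ht0 := ht.1
  have hint := integrableOn_memory_zero hα hα₁ ht0.le hg hLip (by positivity)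
  rw [caputo_eq_memory hα ht0 hint, memory]
  have hηT : η ≤ T' := hη1.trans hT1
  set F : ℝ → ℝ := fun τ => (g t - g (max (t - τ) 0)) / τ ^ (α + 1) with hF
  have hmem : ∀ τ, 0 < τ → max (t - τ) 0 ∈ Icc 0 t := fun τ hτ =>
    ⟨le_max_right _ _, max_le (by linarith) ht0.le⟩
  have hi1 : IntegrableOn F (Ioc 0 η) := hint.mono_set Ioc_subset_Ioi_self
  have hi2 : IntegrableOn F (Ioc η T') :=
    hint.mono_set (fun x hx => lt_trans hη hx.1)
  have hi3 : IntegrableOn F (Ioi T') := hint.mono_set (Ioi_subset_Ioi hT'0.le)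
  have hsplit : ∫ τ in Ioi 0, F τ
      = (∫ τ in Ioc 0 η, F τ) + ((∫ τ in Ioc η T', F τ) + ∫ τ in Ioi T', F τ) := by
    have hd : ∀ a b : ℝ, Disjoint (Ioc a b) (Ioi b) := fun a b => by
      rw [Set.disjoint_left]; intro x hx hx'; exact absurd hx.2 (not_le.2 hx')
    rw [← setIntegral_union (hd _ _) measurableSet_Ioi hi2 hi3, Ioc_union_Ioi_eq_Ioi hηT,
      ← setIntegral_union (hd _ _) measurableSet_Ioi hi1 (hint.mono_set (Ioi_subset_Ioi hη.le)),
      Ioc_union_Ioi_eq_Ioi hη.le]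
  -- Short lags use the Lipschitz bound; the factors `η^(α-1)` and `η^(1-α)` cancel.
  have b1 : -(M / (1 - α)) ≤ ∫ τ in Ioc 0 η, F τ := by
    have : ∫ τ in Ioc 0 η, -(M * η ^ (α - 1)) * τ ^ (-α) = -(M / (1 - α)) := by
      rw [integral_const_mul, integral_Ioc_rpow hα₁ hη.le]
      have : η ^ (α - 1) * η ^ (1 - α) = 1 := by
        rw [← Real.rpow_add hη]; simp
      calc _ = -(M * (η ^ (α - 1) * η ^ (1 - α)) / (1 - α)) := by ring
        _ = _ := by rw [this, mul_one]
    rw [← this]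
    apply setIntegral_mono_on ((integrableOn_Ioc_rpow hα₁ hη.le).const_mul _) hi1 measurableSet_Ioc
    intro τ hτ
    rw [hF, ← div_rpow_add_one hτ.1]
    have hp := Real.rpow_pos_of_pos hτ.1 (α + 1)
    simp only
    gcongr
    have h := (abs_le.1 (hLip _ (hmem τ hτ.1))).1
    have h2 : M * η ^ (α - 1) * (t - max (t - τ) 0) ≤ M * η ^ (α - 1) * τ := by
      gcongr
      linarith [le_max_left (t - τ) 0]
    linarith
  -- Intermediate lags use the Hölder bound; the integrand is then at least `-M/τ`, the source of
  -- the logarithm.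
  have b2 : -(M * (Real.log T' + Real.log (1 / η))) ≤ ∫ τ in Ioc η T', F τ := by
    have hi : IntegrableOn (fun τ : ℝ => 1 / τ) (Ioc η T') := by
      rw [← intervalIntegrable_iff_integrableOn_Ioc_of_le hηT]
      apply ContinuousOn.intervalIntegrable
      rw [uIcc_of_le hηT]
      exact continuousOn_const.div continuousOn_id (fun x hx => (hη.trans_le hx.1).ne')
    have : ∫ τ in Ioc η T', -M * (1 / τ) = -(M * (Real.log T' + Real.log (1 / η))) := by
      rw [integral_const_mul, ← intervalIntegral.integral_of_le hηT, integral_one_div_of_pos hη hT'0,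
        Real.log_div hT'0.ne' hη.ne', Real.log_div one_ne_zero hη.ne', Real.log_one]
      ring
    rw [← this]
    apply setIntegral_mono_on (hi.const_mul _) hi2 measurableSet_Ioc
    intro τ hτ
    have hτ0 : 0 < τ := hη.trans hτ.1
    have hp := Real.rpow_pos_of_pos hτ0 α
    have e : -M * (1 / τ) = -(M * τ ^ α) / τ ^ (α + 1) := by
      rw [Real.rpow_add_one hτ0.ne']; field_simp
    rw [e, hF]
    have hp' := Real.rpow_pos_of_pos hτ0 (α + 1)
    simp only
    gcongr
    have h := (abs_le.1 (hHol _ (hmem τ hτ0))).1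
    have h2 : M * (t - max (t - τ) 0) ^ α ≤ M * τ ^ α := by
      have : 0 ≤ t - max (t - τ) 0 := by linarith [(hmem τ hτ0).2]
      gcongr
      linarith [le_max_left (t - τ) 0]
    linarith
  have b3 : -(M / α) ≤ ∫ τ in Ioi T', F τ := by
    have : ∫ τ in Ioi T', -(M * T' ^ α) * τ ^ (-(α + 1)) = -(M / α) := by
      rw [integral_const_mul, integral_Ioi_rpow_memory hα hT'0, Real.rpow_neg hT'0.le]
      have := (Real.rpow_pos_of_pos hT'0 α).ne'
      field_simp
    rw [← this]
    apply setIntegral_mono_on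
      ((integrableOn_Ioi_rpow_of_lt (by linarith) hT'0).const_mul _) hi3 measurableSet_Ioi
    intro τ hτ
    have hτ0 : 0 < τ := hT'0.trans hτ
    rw [Real.rpow_neg hτ0.le, ← div_eq_mul_inv, hF]
    have hp' := Real.rpow_pos_of_pos hτ0 (α + 1)
    simp only
    gcongr
    have h := (abs_le.1 (hHol _ (hmem τ hτ0))).1
    have h2 : M * (t - max (t - τ) 0) ^ α ≤ M * T' ^ α := by
      have : 0 ≤ t - max (t - τ) 0 := by linarith [(hmem τ hτ0).2]
      gcongr
      linarith [le_max_right (t - τ) 0, ht.2, le_max_left T 1]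
    linarith
  rw [hsplit, mul_assoc, ← mul_neg]
  gcongr
  have hl : 0 ≤ Real.log (1 / η) := Real.log_nonneg (by rw [le_div_iff₀ hη]; linarith)
  have hc : 0 ≤ 1 / (1 - α) + 1 / α + Real.log T' := by positivity
  have e : M * (1 / (1 - α) + 1 / α + Real.log T' + 1) * (1 + Real.log (1 / η))
      = M / (1 - α) + M / α + M * (Real.log T' + Real.log (1 / η)) + M +
        M * ((1 / (1 - α) + 1 / α + Real.log T') * Real.log (1 / η)) := by ring
  have : 0 ≤ M * ((1 / (1 - α) + 1 / α + Real.log T') * Real.log (1 / η)) := by positivity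
  linarith

/-! ### Regularised powers -/

theorem exists_rpow_le {α C e : ℝ} (hα : 0 < α) (hC : 0 < C) (he : 0 < e) :
    ∃ η : ℝ, 0 < η ∧ η ≤ 1 ∧ C * η ^ α ≤ e := by
  refine ⟨min 1 ((e / C) ^ (1 / α)), by positivity, min_le_left _ _, ?_⟩
  calc C * min 1 ((e / C) ^ (1 / α)) ^ α ≤ C * ((e / C) ^ (1 / α)) ^ α := by
        gcongr; exact min_le_right _ _
    _ = e := by
        rw [← Real.rpow_mul (by positivity), one_div_mul_cancel hα.ne', Real.rpow_one]
        field_simp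

/-- The regularised power `M (r² + η²) ^ (α / 2)`. -/
def smoothPow (α M η r : ℝ) : ℝ := M * √(r ^ 2 + η ^ 2) ^ α

theorem contDiff_smoothPow (α M : ℝ) {η : ℝ} (hη : 0 < η) : ContDiff ℝ 1 (smoothPow α M η) := by
  unfold smoothPow
  have h0 : ∀ x : ℝ, x ^ 2 + η ^ 2 ≠ 0 := fun x => by positivity
  apply contDiff_const.mul
  apply ContDiff.rpow_const_of_ne
  · exact ContDiff.sqrt (by fun_prop) h0
  · intro x
    exact (Real.sqrt_pos.2 (by positivity)).ne'

theorem sqrt_sq_add_sq_le (η a b : ℝ) : √(a ^ 2 + η ^ 2) ≤ √(b ^ 2 + η ^ 2) + |a - b| := by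
  have h0 := abs_nonneg (a - b)
  rw [Real.sqrt_le_left (by positivity)]
  have h1 := Real.sq_sqrt (show 0 ≤ b ^ 2 + η ^ 2 by positivity)
  have h2 : |b| ≤ √(b ^ 2 + η ^ 2) := Real.abs_le_sqrt (by nlinarith [sq_nonneg η])
  have h3 : b * (a - b) ≤ |b| * |a - b| := by rw [← abs_mul]; exact le_abs_self _
  nlinarith [sq_abs (a - b)]

theorem rpow_sub_rpow_le {α η x y : ℝ} (hα₁ : α < 1) (hη : 0 < η) (hy : η ≤ y) (hxy : y ≤ x) :
    x ^ α - y ^ α ≤ η ^ (α - 1) * (x - y) := by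
  have hy0 : 0 < y := by linarith
  have hx0 : 0 < x := by linarith
  have e : ∀ z : ℝ, 0 < z → z ^ α = z ^ (α - 1) * z := fun z hz => by
    rw [← Real.rpow_add_one hz.ne']; simp
  have h1 : x ^ (α - 1) ≤ y ^ (α - 1) :=
    Real.rpow_le_rpow_of_nonpos hy0 hxy (by linarith)
  have h2 : y ^ (α - 1) ≤ η ^ (α - 1) :=
    Real.rpow_le_rpow_of_nonpos hη hy (by linarith)
  rw [e x hx0, e y hy0]
  nlinarith

theorem smoothPow_sub_le_holder {α M η : ℝ} (hα : 0 < α) (hα₁ : α < 1) (hM : 0 ≤ M) (a b : ℝ) :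
    |smoothPow α M η a - smoothPow α M η b| ≤ M * |a - b| ^ α := by
  have key : ∀ a b : ℝ, smoothPow α M η a - smoothPow α M η b ≤ M * |a - b| ^ α := by
    intro a b
    unfold smoothPow
    rw [← mul_sub]
    gcongr
    rw [sub_le_iff_le_add']
    refine (Real.rpow_le_rpow (Real.sqrt_nonneg _) (sqrt_sq_add_sq_le η a b) hα.le).trans ?_
    exact Real.rpow_add_le_add_rpow (Real.sqrt_nonneg _) (abs_nonneg _) hα.le hα₁.le
  rw [abs_le]
  refine ⟨?_, key a b⟩
  have := key b a
  rw [abs_sub_comm] at this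
  linarith

theorem smoothPow_sub_le_lipschitz {α M η : ℝ} (hα : 0 < α) (hα₁ : α < 1) (hM : 0 ≤ M)
    (hη : 0 < η) (a b : ℝ) :
    |smoothPow α M η a - smoothPow α M η b| ≤ M * η ^ (α - 1) * |a - b| := by
  have key : ∀ a b : ℝ, smoothPow α M η a - smoothPow α M η b ≤ M * η ^ (α - 1) * |a - b| := by
    intro a b
    unfold smoothPow
    rw [← mul_sub, mul_assoc]
    gcongr
    have hη' : 0 < η ^ (α - 1) := Real.rpow_pos_of_pos hη _
    rcases le_total √(b ^ 2 + η ^ 2) √(a ^ 2 + η ^ 2) with h | h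
    · refine (rpow_sub_rpow_le hα₁ hη ?_ h).trans ?_
      · exact Real.le_sqrt_of_sq_le (by nlinarith [sq_nonneg b])
      · gcongr
        linarith [sqrt_sq_add_sq_le η a b]
    · have := Real.rpow_le_rpow (Real.sqrt_nonneg _) h hα.le
      have : 0 ≤ η ^ (α - 1) * |a - b| := by positivity
      linarith
  rw [abs_le]
  refine ⟨?_, key a b⟩
  have := key b a
  rw [abs_sub_comm] at this
  linarith

theorem mul_rpow_le_smoothPow {α M : ℝ} (hα : 0 < α) (hM : 0 ≤ M) (η r : ℝ) :
    M * |r| ^ α ≤ smoothPow α M η r := by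
  unfold smoothPow
  gcongr
  exact Real.abs_le_sqrt (by nlinarith [sq_nonneg η])

theorem smoothPow_mono {α M : ℝ} (hα : 0 < α) (hM : 0 ≤ M) (η : ℝ) {r s : ℝ} (h : |r| ≤ |s|) :
    smoothPow α M η r ≤ smoothPow α M η s := by
  unfold smoothPow
  have h2 := sq_le_sq.2 h
  have h3 : √(r ^ 2 + η ^ 2) ≤ √(s ^ 2 + η ^ 2) := Real.sqrt_le_sqrt (by linarith)
  gcongr

theorem smoothPow_zero {α M η : ℝ} (hη : 0 ≤ η) : smoothPow α M η 0 = M * η ^ α := by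
  simp [smoothPow, Real.sqrt_sq hη]

theorem smoothPow_nonneg {α M : ℝ} (hM : 0 ≤ M) (η r : ℝ) : 0 ≤ smoothPow α M η r := by
  unfold smoothPow; positivity

/-! ### Reflection and separable test functions -/

theorem caputoJ_neg (α : ℝ) (f : ℝ → ℝ) (t : ℝ) :
    caputoJ α (fun s => -f s) t = -caputoJ α f t := by
  unfold caputoJ; ring

theorem caputoK_neg (α a b : ℝ) (f : ℝ → ℝ) (t : ℝ) :
    caputoK α a b (fun s => -f s) t = -caputoK α a b f t := by
  unfold caputoK
  rw [← mul_neg, ← intervalIntegral.integral_neg]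
  congr 1
  apply intervalIntegral.integral_congr
  intro τ _
  simp only
  ring

theorem memory_neg (α ρ : ℝ) (f : ℝ → ℝ) (t : ℝ) :
    memory α ρ (fun s => -f s) t = -memory α ρ f t := by
  unfold memory
  rw [← mul_neg, ← integral_neg]
  congr 2
  ext τ
  ring

theorem gradient_neg_fun (f : Space N → ℝ) (x : Space N) :
    gradient (fun z => -f z) x = -gradient f x := by
  unfold gradient
  rw [fderiv_fun_neg, map_neg]

/-- Lets every estimate be proved for subsolutions only. -/
theorem IsSupersolution.neg {T α ε : ℝ} {H : Space N → Space N → ℝ} {u₀ : Space N → ℝ}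
    {u : Space N → ℝ → ℝ} (h : IsSupersolution T α ε H u₀ u) :
    IsSubsolution T α ε (fun x p => -H x (-p)) (fun x => -u₀ x) (fun x t => -u x t) := by
  refine ⟨?_, fun x => neg_le_neg (h.2.1 x), fun φ hφ x t ht hmax => ?_⟩
  · intro z hz y hy
    have h1 := h.1 z hz (-y) (by simp only [Function.uncurry] at hy ⊢; linarith)
    filter_upwards [h1] with w hw
    simp only [Function.uncurry] at hw ⊢
    linarith
  · have hneg : IsTestFunction T (fun x t => -φ x t) := ⟨hφ.1.neg, hφ.2.neg⟩
    have := h.2.2 _ hneg x t ht (fun z hz => by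
      have := hmax hz
      simp only [mem_ofPred_eq] at this ⊢
      linarith)
    unfold operator at this ⊢
    rw [caputoJ_neg, caputoK_neg, gradient_neg_fun] at this
    simp only
    linarith

theorem isTestFunction_separable {T : ℝ} {ψ : Space N → ℝ} {g : ℝ → ℝ} (hψ : ContDiff ℝ 1 ψ)
    (hg : ContDiffOn ℝ 1 g (Ioc 0 T)) (hg' : ContinuousOn g (Icc 0 T)) :
    IsTestFunction T (fun x t => ψ x + g t) := by
  constructor
  · exact (hψ.comp contDiff_fst).contDiffOn.add
      (hg.comp contDiff_snd.contDiffOn (fun z hz => hz.2))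
  · exact (hψ.continuous.comp continuous_fst).continuousOn.add
      (hg'.comp continuous_snd.continuousOn (fun z hz => hz.2))

theorem operator_separable (α ε : ℝ) (H : Space N → Space N → ℝ) {ψ : Space N → ℝ} (g : ℝ → ℝ)
    {x p : Space N} (hp : HasGradientAt ψ p x) (t : ℝ) :
    operator α ε H (fun x t => ψ x + g t) x t
      = caputoJ α g t + caputoK α 0 t g t + H (ε⁻¹ • x) p := by
  unfold operator
  have h1 : gradient (fun z => ψ z + g t) x = p :=
    (hasGradientAt_iff_hasFDerivAt.1 hp |>.add_const (g t)).hasGradientAt.gradient.trans (by simp)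
  rw [h1]
  simp [caputoJ, caputoK]

theorem IsSubsolution.test_separable {T α ε : ℝ} {H : Space N → Space N → ℝ} {u₀ : Space N → ℝ}
    {u : Space N → ℝ → ℝ} (h : IsSubsolution T α ε H u₀ u) {ψ : Space N → ℝ} {g : ℝ → ℝ}
    (hψ : ContDiff ℝ 1 ψ) (hg : ContDiffOn ℝ 1 g (Ioc 0 T)) (hg' : ContinuousOn g (Icc 0 T))
    {x p : Space N} (hp : HasGradientAt ψ p x) {t : ℝ} (ht : t ∈ Ioc 0 T)
    (hmax : ∀ y, ∀ s ∈ Icc 0 T, u y s - ψ y - g s ≤ u x t - ψ x - g t) :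
    caputoJ α g t + caputoK α 0 t g t + H (ε⁻¹ • x) p ≤ 0 := by
  rw [← operator_separable α ε H g hp t]
  refine h.2.2 _ (isTestFunction_separable hψ hg hg') x t ht ?_
  intro z hz
  have := hmax z.1 z.2 hz.2
  simp only [mem_ofPred_eq]
  linarith

theorem isClosed_closedDomain (N : ℕ) (T : ℝ) : IsClosed (closedDomain N T) :=
  isClosed_univ.prod isClosed_Icc

theorem exists_max_separable {T : ℝ} (hT : 0 < T) {u : Space N → ℝ → ℝ}
    (hu : ContinuousOn (Function.uncurry u) (closedDomain N T)) (hb : IsBounded T u)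
    {ψ : Space N → ℝ} {g : ℝ → ℝ} (hψ : Continuous ψ) (hg : ContinuousOn g (Icc 0 T))
    {a : Space N} {c : ℝ} (hc : 0 < c) (hcoer : ∀ x, c * ‖x - a‖ ≤ ψ x) :
    ∃ x, ∃ t ∈ Icc 0 T, ∀ y, ∀ s ∈ Icc 0 T, u y s - ψ y - g s ≤ u x t - ψ x - g t := by
  obtain ⟨B, hB⟩ := hb
  obtain ⟨G, hG⟩ := isCompact_Icc.exists_bound_of_continuousOn hg
  have hcont : ContinuousOn (fun z : Space N × ℝ => u z.1 z.2 - ψ z.1 - g z.2)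
      (closedDomain N T) :=
    (hu.sub (hψ.comp continuous_fst).continuousOn).sub
      (hg.comp continuous_snd.continuousOn (fun z hz => hz.2))
  have h0 : ((a, 0) : Space N × ℝ) ∈ closedDomain N T := ⟨mem_univ _, le_rfl, hT.le⟩
  set v : ℝ := u a 0 - ψ a - g 0
  have hK : IsCompact (Metric.closedBall a ((B + G - v) / c) ×ˢ Icc 0 T) :=
    (isCompact_closedBall _ _).prod isCompact_Icc
  obtain ⟨z, hz, hmax⟩ := hcont.exists_isMaxOn' (isClosed_closedDomain N T) h0 (by
    rw [eventually_inf_principal]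
    filter_upwards [hK.compl_mem_cocompact] with z hz hzd
    by_contra! hlt
    apply hz
    refine ⟨?_, hzd.2⟩
    rw [Metric.mem_closedBall, dist_eq_norm, le_div_iff₀ hc]
    have h1 := (abs_le.1 (hB z.1 z.2 hzd.2)).2
    have h2 := (abs_le.1 (hG z.2 hzd.2)).1
    have h3 := hcoer z.1
    linarith [mul_comm c ‖z.1 - a‖])
  exact ⟨z.1, z.2, hz.2, fun y s hs => hmax (show (y, s) ∈ closedDomain N T from ⟨mem_univ _, hs⟩)⟩

/-! ### Growth from the initial time -/

/-- A subsolution grows from its initial values at most like `C t ^ α`. -/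
theorem IsSubsolution.initial_bound {T α ε : ℝ} (hT : 0 < T) (hα : 0 < α) (hα₁ : α < 1)
    {H : Space N → Space N → ℝ} {u₀ : Space N → ℝ} {u : Space N → ℝ → ℝ}
    (h : IsSubsolution T α ε H u₀ u)
    (hu : ContinuousOn (Function.uncurry u) (closedDomain N T)) (hb : IsBounded T u)
    {L A C : ℝ} (hL : 0 < L) (hLip : ∀ x y, |u₀ x - u₀ y| ≤ L * ‖x - y‖)
    (hA : ∀ x p, ‖p‖ ≤ L → -A ≤ H x p) (hC : 0 < C) (hCA : A < C / Real.Gamma (1 - α))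
    (y : Space N) {s : ℝ} (hs : s ∈ Icc 0 T) : u y s ≤ u₀ y + C * s ^ α := by
  apply le_of_forall_pos_le_add
  intro e he
  set σ : ℝ := e / L with hσd
  have hσ : 0 < σ := by positivity
  have hΓ : 0 < Real.Gamma (1 - α) := Real.Gamma_pos_of_pos (by linarith)
  set ψ : Space N → ℝ := fun x => L * smoothDist σ y x with hψd
  -- Admissible although not `C¹` at `0`, since test functions are `C¹` only on `(0, T]`. Its `J`
  -- term is the constant `C / Γ(1 - α) > A` and its `K` term is nonnegative, which excludes a
  -- maximum at a positive time.
  set g : ℝ → ℝ := fun t => C * t ^ α with hgd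
  have hψ : ContDiff ℝ 1 ψ := contDiff_const.mul (contDiff_smoothDist hσ y)
  have hg : ContDiffOn ℝ 1 g (Ioc 0 T) := by
    apply contDiffOn_const.mul
    exact contDiffOn_id.rpow_const_of_ne (fun x hx => hx.1.ne')
  have hg' : Continuous g := continuous_const.mul (Real.continuous_rpow_const hα.le)
  obtain ⟨x, t, ht, hmax⟩ := exists_max_separable hT hu hb hψ.continuous hg'.continuousOn
    (a := y) hL (fun x => by
      simp only [hψd]; gcongr; exact norm_le_smoothDist σ y x)
  have ht0 : t = 0 := by
    by_contra hne
    have htpos : 0 < t := lt_of_le_of_ne ht.1 (Ne.symm hne)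
    have hgrad := hasGradientAt_const_mul (hasGradientAt_smoothDist hσ y x) L
    have key := h.test_separable hψ hg hg'.continuousOn hgrad ⟨htpos, ht.2⟩ hmax
    have hH := hA (ε⁻¹ • x) (L • ((smoothDist σ y x)⁻¹ • (x - y))) (by
      rw [norm_smul, Real.norm_of_nonneg hL.le]
      nlinarith [norm_gradient_smoothDist_le hσ y x])
    have hJ : caputoJ α g t = C / Real.Gamma (1 - α) := by
      have := (Real.rpow_pos_of_pos htpos α).ne'
      simp only [caputoJ, hgd, Real.zero_rpow hα.ne']
      field_simp
      ring
    have hK : 0 ≤ caputoK α 0 t g t := by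
      unfold caputoK
      apply mul_nonneg (gammaFactor_pos hα hα₁).le
      apply intervalIntegral.integral_nonneg htpos.le
      intro τ hτ
      apply div_nonneg _ (Real.rpow_nonneg hτ.1 _)
      simp only [hgd, sub_nonneg]
      have : 0 ≤ t - τ := by linarith [hτ.2]
      gcongr
      linarith [hτ.1]
    linarith
  subst ht0
  have h1 := hmax y s hs
  have h2 := h.2.1 x
  have h3 := (abs_le.1 (hLip x y)).2
  have h4 : L * ‖x - y‖ ≤ ψ x := by
    simp only [hψd]; gcongr; exact norm_le_smoothDist σ y x
  have h5 : ψ y ≤ e := by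
    have := smoothDist_le hσ y y
    simp only [sub_self, norm_zero, zero_add] at this
    calc ψ y ≤ L * σ := by simp only [hψd]; gcongr
      _ = e := by rw [hσd]; field_simp
  have h6 : g 0 = 0 := by simp [hgd, Real.zero_rpow hα.ne']
  have h7 : g s = C * s ^ α := rfl
  linarith

/-! ### The viscosity inequality with the past of the solution -/

/-- Applied to the gap `w` between a test function and `u`. Subtracting `q` and adding `Λ‖y - x‖²`
keeps the test function above `u`, leaves it unchanged in time near the contact point, and brings it
within `3e` of `u(x, ·)` at times before `t - ρ`. -/
theorem exists_minorant {T : ℝ} {w : Space N → ℝ → ℝ}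
    (hw : ContinuousOn (Function.uncurry w) (closedDomain N T))
    (hw0 : ∀ y, ∀ s ∈ Icc 0 T, 0 ≤ w y s) (x : Space N) {t ρ e : ℝ}
    (hρ : 0 < ρ) (ht : t ≤ T) (he : 0 < e) :
    ∃ (q : ℝ → ℝ) (Λ : ℝ), ContDiff ℝ 1 q ∧
      (∀ y, ∀ s ∈ Icc 0 T, q s - Λ * ‖y - x‖ ^ 2 ≤ w y s) ∧
      (∀ s ∈ Icc 0 T, -(3 * e) ≤ q s) ∧
      (∀ s ∈ Icc 0 (t - ρ), w x s - 3 * e ≤ q s) ∧ ∀ s, t - ρ / 2 ≤ s → q s = 0 := by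
  have hwx : ContinuousOn (w x) (Icc 0 T) :=
    hw.comp (f := fun s : ℝ => ((x, s) : Space N × ℝ)) (by fun_prop) (fun s hs => ⟨mem_univ _, hs⟩)
  -- Accuracy `e` puts `P` between `w x - 3e` and `w x - e`; the upper margin `e` absorbs the
  -- variation of `w` for `y` close to `x`.
  obtain ⟨P, hP⟩ := exists_polynomial_near_of_continuousOn 0 T (fun s => w x s - 2 * e)
    (hwx.sub continuousOn_const) e he
  have hPc : ContDiff ℝ 1 (fun s => P.eval s) := by
    simpa using P.contDiff_aeval (𝕜 := ℝ) 1
  obtain ⟨S, hS⟩ := (isCompact_Icc (a := (0 : ℝ)) (b := T)).exists_bound_of_continuousOn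
    hPc.continuous.continuousOn
  have hK : IsCompact (Metric.closedBall x 1 ×ˢ Icc (0 : ℝ) T) :=
    (isCompact_closedBall _ _).prod isCompact_Icc
  have huc := hK.uniformContinuousOn_of_continuous (hw.mono (fun z hz => ⟨mem_univ _, hz.2⟩))
  rw [Metric.uniformContinuousOn_iff] at huc
  obtain ⟨d, hd, hunif⟩ := huc e he
  set r : ℝ := min d 1
  have hr : 0 < r := by positivity
  set χ : ℝ → ℝ := fun s => Real.smoothTransition ((t - ρ / 2 - s) / (ρ / 2))
  have hχ0 : ∀ s, 0 ≤ χ s := fun s => Real.smoothTransition.nonneg _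
  have hχ1 : ∀ s, χ s ≤ 1 := fun s => Real.smoothTransition.le_one _
  have hχc : ContDiff ℝ 1 χ := Real.smoothTransition.contDiff.comp (by fun_prop)
  -- With this `Λ` the quadratic term already exceeds `P` once `‖y - x‖ ≥ r`.
  refine ⟨fun s => P.eval s * χ s, max S 0 / r ^ 2, hPc.mul hχc, ?_, ?_, ?_, ?_⟩
  · intro y s hs
    have hPs := abs_lt.1 (hP s hs)
    rcases lt_or_ge ‖y - x‖ r with hy | hy
    · have hdist : dist ((y, s) : Space N × ℝ) (x, s) < d := by
        rw [Prod.dist_eq, dist_self, max_eq_left dist_nonneg, dist_eq_norm]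
        exact hy.trans_le (min_le_left _ _)
      have h1 := hunif (y, s) ⟨by
        rw [Metric.mem_closedBall, dist_eq_norm]; exact hy.le.trans (min_le_right _ _), hs⟩
        (x, s) ⟨by simp, hs⟩ hdist
      rw [Real.dist_eq] at h1
      have h2 := (abs_lt.1 h1).1
      simp only [Function.uncurry] at h2
      have h3 := hw0 y s hs
      have h4 : P.eval s * χ s ≤ w y s := by
        rcases le_or_gt (P.eval s) 0 with h | h
        · nlinarith [hχ0 s]
        · nlinarith [hχ1 s]
      have h5 : 0 ≤ max S 0 / r ^ 2 * ‖y - x‖ ^ 2 := by positivity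
      linarith
    · have h1 : P.eval s * χ s ≤ max S 0 := by
        have := hS s hs
        rw [Real.norm_eq_abs] at this
        have h2 := (le_abs_self _).trans (this.trans (le_max_left S 0))
        have h3 : (0 : ℝ) ≤ max S 0 := le_max_right _ _
        nlinarith [hχ0 s, hχ1 s]
      have h2 : max S 0 ≤ max S 0 / r ^ 2 * ‖y - x‖ ^ 2 := by
        rw [div_mul_eq_mul_div, le_div_iff₀ (by positivity)]
        gcongr
      linarith [hw0 y s hs]
  · intro s hs
    have hPs := abs_lt.1 (hP s hs)
    have h3 := hw0 x s hs
    nlinarith [hχ0 s, hχ1 s]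
  · intro s hs
    have hPs := abs_lt.1 (hP s ⟨hs.1, hs.2.trans (by linarith)⟩)
    have : χ s = 1 := Real.smoothTransition.one_of_one_le (by
      rw [le_div_iff₀ (by positivity)]; linarith [hs.2])
    simp only [this, mul_one]
    linarith
  · intro s hs
    have : χ s = 0 := Real.smoothTransition.zero_of_nonpos
      (div_nonpos_of_nonpos_of_nonneg (by linarith) (by positivity))
    simp only [this, mul_zero]

/-- At a maximum of `u - ψ - g`, the equation holds with the test function replaced by `u` at
times further than `ρ` in the past, up to an error of order `ρ ^ (1 - α)`. -/
theorem IsSubsolution.memory_le {T α ε : ℝ} (hα : 0 < α) (hα₁ : α < 1)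
    {H : Space N → Space N → ℝ} {u₀ : Space N → ℝ} {u : Space N → ℝ → ℝ}
    (h : IsSubsolution T α ε H u₀ u)
    (hu : ContinuousOn (Function.uncurry u) (closedDomain N T))
    {ψ : Space N → ℝ} {g : ℝ → ℝ} (hψ : ContDiff ℝ 1 ψ) (hg : ContDiff ℝ 1 g)
    {x p : Space N} (hp : HasGradientAt ψ p x) {t : ℝ} (ht : t ∈ Ioc 0 T)
    (hmax : ∀ y, ∀ s ∈ Icc 0 T, u y s - ψ y - g s ≤ u x t - ψ x - g t) :
    ∃ C : ℝ, ∀ ρ ∈ Ioo 0 t, memory α ρ (u x) t + H (ε⁻¹ • x) p ≤ C * ρ ^ (1 - α) := by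
  have hΓ := gammaFactor_pos hα hα₁
  have h1α : 0 < 1 - α := by linarith
  have ht0 := ht.1
  have lip : ∀ f : ℝ → ℝ, ContDiff ℝ 1 f →
      ∃ G : ℝ, 0 ≤ G ∧ ∀ s ∈ Icc 0 t, |f t - f s| ≤ G * (t - s) := by
    intro f hf
    obtain ⟨K, hK⟩ := hf.contDiffOn.exists_lipschitzOnWith one_ne_zero (convex_Icc 0 t) isCompact_Icc
    refine ⟨K, K.2, fun s hs => ?_⟩
    have := hK.dist_le_mul t ⟨ht0.le, le_rfl⟩ s hs
    rwa [Real.dist_eq, Real.dist_eq, abs_of_nonneg (sub_nonneg.2 hs.2)] at this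
  obtain ⟨G, hG0, hG⟩ := lip g hg
  refine ⟨α / Real.Gamma (1 - α) * ((G + 1) / (1 - α) + 1 / (2 * α)), fun ρ hρ => ?_⟩
  have hρ0 := hρ.1
  have hux : ContinuousOn (u x) (Icc 0 t) :=
    hu.comp (f := fun s : ℝ => ((x, s) : Space N × ℝ)) (by fun_prop)
      (fun s hs => ⟨mem_univ _, hs.1, hs.2.trans ht.2⟩)
  set w : Space N → ℝ → ℝ := fun y s => ψ y + g s - u y s - (ψ x + g t - u x t) with hwd
  have hw : ContinuousOn (Function.uncurry w) (closedDomain N T) :=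
    (((hψ.continuous.comp continuous_fst).add
      (hg.continuous.comp continuous_snd)).continuousOn.sub hu).sub continuousOn_const
  have hw0 : ∀ y, ∀ s ∈ Icc 0 T, 0 ≤ w y s := fun y s hs => by
    have := hmax y s hs
    simp only [hwd]; linarith
  -- With `e = ρ/6` the error is `3e = ρ/2`. It is at most `τ` for lags `τ > ρ/2`, below which `q`
  -- vanishes, and it contributes order `ρ · ρ^(-α)` for lags beyond `ρ`.
  obtain ⟨q, Λ, hq, hqw, hq3, hqx, hqz⟩ :=
    exists_minorant hw hw0 x hρ0 ht.2 (show 0 < ρ / 6 by positivity)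
  have hqt : q t = 0 := hqz t (by linarith)
  have hgq : ContDiff ℝ 1 (fun s => g s - q s) := hg.sub hq
  have hgrad : HasGradientAt (fun y => ψ y + Λ * ‖y - x‖ ^ 2) p x := by
    simpa using hasGradientAt_add hp (hasGradientAt_const_mul (hasGradientAt_norm_sq_sub x x) Λ)
  have key := h.test_separable
    (hψ.add (contDiff_const.mul ((contDiff_id.sub contDiff_const).norm_sq ℝ)))
    hgq.contDiffOn hgq.continuous.continuousOn hgrad ht (fun y s hs => by
      have := hqw y s hs
      simp only [hwd] at this
      simp only [id, hqt, sub_self, norm_zero]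
      linarith)
  -- `G'` depends on `ρ` and serves integrability only; the final constant uses `G`, which comes
  -- from `g` alone.
  obtain ⟨G', hG'0, hG'⟩ := lip _ hgq
  have hint := integrableOn_memory_zero hα hα₁ ht0.le hgq.continuous.continuousOn hG' hG'0
  rw [caputo_eq_memory hα ht0 hint, memory] at key
  set F : ℝ → ℝ := fun τ => ((g t - q t) - (g (max (t - τ) 0) - q (max (t - τ) 0))) / τ ^ (α + 1)
    with hF
  have hIu := integrableOn_memory hα ht0.le hρ0 hux
  have hd : Disjoint (Ioc 0 ρ) (Ioi ρ) := by
    rw [Set.disjoint_left]; intro x hx hx'; exact absurd hx.2 (not_le.2 hx')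
  have hi1 : IntegrableOn F (Ioc 0 ρ) := hint.mono_set Ioc_subset_Ioi_self
  have hi2 : IntegrableOn F (Ioi ρ) := hint.mono_set (Ioi_subset_Ioi hρ0.le)
  have hsplit : ∫ τ in Ioi 0, F τ = (∫ τ in Ioc 0 ρ, F τ) + ∫ τ in Ioi ρ, F τ := by
    rw [← setIntegral_union hd measurableSet_Ioi hi1 hi2, Ioc_union_Ioi_eq_Ioi hρ0.le]
  have b1 : -((G + 1) / (1 - α) * ρ ^ (1 - α)) ≤ ∫ τ in Ioc 0 ρ, F τ := by
    have : ∫ τ in Ioc 0 ρ, -(G + 1) * τ ^ (-α) = -((G + 1) / (1 - α) * ρ ^ (1 - α)) := by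
      rw [integral_const_mul, integral_Ioc_rpow hα₁ hρ0.le]
      ring
    rw [← this]
    apply setIntegral_mono_on ((integrableOn_Ioc_rpow hα₁ hρ0.le).const_mul _) hi1 measurableSet_Ioc
    intro τ hτ
    have hτ0 := hτ.1
    have hm : max (t - τ) 0 = t - τ := max_eq_left (by linarith [hτ.2, hρ.2])
    rw [hF, ← div_rpow_add_one hτ0]
    have hp := Real.rpow_pos_of_pos hτ0 (α + 1)
    simp only [hm, hqt]
    gcongr
    have hs : t - τ ∈ Icc 0 t := ⟨by linarith [hτ.2, hρ.2], by linarith⟩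
    have h1 := (abs_le.1 (hG _ hs)).1
    have h2 : -τ ≤ q (t - τ) := by
      rcases le_or_gt (t - ρ / 2) (t - τ) with h' | h'
      · rw [hqz _ h']; linarith
      · linarith [hq3 (t - τ) ⟨hs.1, hs.2.trans ht.2⟩]
    linarith
  have b2 : (∫ τ in Ioi ρ, (u x t - u x (max (t - τ) 0)) / τ ^ (α + 1))
      - 1 / (2 * α) * ρ ^ (1 - α) ≤ ∫ τ in Ioi ρ, F τ := by
    have hi := integrableOn_Ioi_rpow_of_lt (by linarith : -(α + 1) < -1) hρ0
    have : ∫ τ in Ioi ρ, ((u x t - u x (max (t - τ) 0)) / τ ^ (α + 1) - ρ / 2 * τ ^ (-(α + 1)))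
        = (∫ τ in Ioi ρ, (u x t - u x (max (t - τ) 0)) / τ ^ (α + 1))
          - 1 / (2 * α) * ρ ^ (1 - α) := by
      rw [integral_sub hIu (hi.const_mul _), integral_const_mul, integral_Ioi_rpow_memory hα hρ0,
        show 1 - α = -α + 1 by ring, Real.rpow_add_one hρ0.ne']
      field_simp
    rw [← this]
    apply setIntegral_mono_on (hIu.sub (hi.const_mul _)) hi2 measurableSet_Ioi
    intro τ hτ
    have hτρ : ρ < τ := hτ
    have hτ0 : 0 < τ := hρ0.trans hτ
    have hp := Real.rpow_pos_of_pos hτ0 (α + 1)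
    simp only [Pi.sub_apply, hF, hqt]
    rw [Real.rpow_neg hτ0.le, ← div_eq_mul_inv, ← sub_div]
    refine div_le_div_of_nonneg_right ?_ hp.le
    have h1 := hqx (max (t - τ) 0)
      ⟨le_max_right _ _, max_le (by linarith) (by linarith [hρ.2])⟩
    simp only [hwd] at h1
    linarith
  rw [hsplit] at key
  have hfin := mul_le_mul_of_nonneg_left (add_le_add b1 b2) hΓ.le
  unfold memory
  linarith [hfin]

/-! ### Hölder continuity in time by doubling variables -/

/-- The difference of the integrands is nonnegative at every lag, so only lags beyond `T` need be
kept. There both histories have reached time `0` and the gap is at least `θ`. The bound does not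
depend on `ρ`. -/
theorem memory_sub_ge {α T t s ρ θ : ℝ} (hα : 0 < α) (hα₁ : α < 1) (hT : 0 < T) {f₁ f₂ : ℝ → ℝ}
    (ht : t ∈ Icc 0 T) (hs : s ∈ Icc 0 T) (hρ : 0 < ρ) (hρT : ρ ≤ T)
    (hf₁ : ContinuousOn f₁ (Icc 0 t)) (hf₂ : ContinuousOn f₂ (Icc 0 s))
    (h : ∀ τ, 0 < τ → f₂ s - f₂ (max (s - τ) 0) ≤ f₁ t - f₁ (max (t - τ) 0))
    (h0 : θ ≤ (f₁ t - f₁ 0) - (f₂ s - f₂ 0)) :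
    α / Real.Gamma (1 - α) * (θ * (T ^ (-α) / α)) ≤ memory α ρ f₁ t - memory α ρ f₂ s := by
  have hΓ := gammaFactor_pos hα hα₁
  have hi₁ := integrableOn_memory hα ht.1 hρ hf₁
  have hi₂ := integrableOn_memory hα hs.1 hρ hf₂
  have hi := hi₁.sub hi₂
  unfold memory
  rw [← mul_sub, ← integral_sub hi₁ hi₂]
  refine mul_le_mul_of_nonneg_left ?_ hΓ.le
  rw [← integral_Ioi_rpow_memory hα hT, ← integral_const_mul]
  have hsub : Ioi T ⊆ Ioi ρ := Ioi_subset_Ioi hρT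
  refine le_trans ?_ (setIntegral_mono_set hi ?_ hsub.eventuallyLE)
  · apply setIntegral_mono_on
      ((integrableOn_Ioi_rpow_of_lt (by linarith) hT).const_mul _) (hi.mono_set hsub)
      measurableSet_Ioi
    intro τ hτ
    have hτT : T < τ := hτ
    have hτ0 : 0 < τ := hT.trans hτT
    have hp := Real.rpow_pos_of_pos hτ0 (α + 1)
    simp only [Pi.sub_apply]
    rw [max_eq_right (by linarith [ht.2] : t - τ ≤ 0),
      max_eq_right (by linarith [hs.2] : s - τ ≤ 0), Real.rpow_neg hτ0.le, ← div_eq_mul_inv, ← sub_div]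
    exact div_le_div_of_nonneg_right h0 hp.le
  · filter_upwards [ae_restrict_mem measurableSet_Ioi] with τ hτ
    have hτ0 : 0 < τ := hρ.trans hτ
    have hp := Real.rpow_pos_of_pos hτ0 (α + 1)
    simp only [Pi.zero_apply, ← sub_div]
    exact div_nonneg (sub_nonneg.2 (h τ hτ0)) hp.le

theorem exists_max_doubled {T : ℝ} {u : Space N → ℝ → ℝ}
    (hu : ContinuousOn (Function.uncurry u) (closedDomain N T)) (hb : IsBounded T u)
    {g : ℝ → ℝ} (hg : Continuous g) (hg0 : ∀ r, 0 ≤ g r) {δ κ : ℝ} (hδ : 0 < δ) (hκ : 0 < κ)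
    {x₀ : Space N} {t₀ s₀ : ℝ} (ht₀ : t₀ ∈ Icc 0 T) (hs₀ : s₀ ∈ Icc 0 T)
    (h0 : 0 ≤ u x₀ t₀ - u x₀ s₀ - g (t₀ - s₀) - (2 * δ)⁻¹ * ‖x₀ - x₀‖ ^ 2
      - κ * smoothDist 1 0 x₀) :
    ∃ x, ∃ t ∈ Icc 0 T, ∃ y, ∃ s ∈ Icc 0 T, ∀ x', ∀ t' ∈ Icc 0 T, ∀ y', ∀ s' ∈ Icc 0 T,
      u x' t' - u y' s' - g (t' - s') - (2 * δ)⁻¹ * ‖x' - y'‖ ^ 2 - κ * smoothDist 1 0 x'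
        ≤ u x t - u y s - g (t - s) - (2 * δ)⁻¹ * ‖x - y‖ ^ 2 - κ * smoothDist 1 0 x := by
  obtain ⟨B, hB⟩ := hb
  set Φ : (Space N × ℝ) × (Space N × ℝ) → ℝ := fun z =>
    u z.1.1 z.1.2 - u z.2.1 z.2.2 - g (z.1.2 - z.2.2) - (2 * δ)⁻¹ * ‖z.1.1 - z.2.1‖ ^ 2
      - κ * smoothDist 1 0 z.1.1 with hΦ
  have hsd : Continuous (smoothDist 1 (0 : Space N)) := (contDiff_smoothDist one_pos 0).continuous
  have hcont : ContinuousOn Φ (closedDomain N T ×ˢ closedDomain N T) := by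
    have h1 : ContinuousOn (fun z : (Space N × ℝ) × (Space N × ℝ) => u z.1.1 z.1.2)
        (closedDomain N T ×ˢ closedDomain N T) :=
      hu.comp continuous_fst.continuousOn (fun z hz => hz.1)
    have h2 : ContinuousOn (fun z : (Space N × ℝ) × (Space N × ℝ) => u z.2.1 z.2.2)
        (closedDomain N T ×ˢ closedDomain N T) :=
      hu.comp continuous_snd.continuousOn (fun z hz => hz.2)
    refine (((h1.sub h2).sub ?_).sub ?_).sub ?_
    · exact Continuous.continuousOn (by fun_prop)
    · exact Continuous.continuousOn (by fun_prop)
    · exact Continuous.continuousOn (by fun_prop)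
  have hmem0 : (((x₀, t₀), (x₀, s₀)) : (Space N × ℝ) × (Space N × ℝ)) ∈
      closedDomain N T ×ˢ closedDomain N T := ⟨⟨mem_univ _, ht₀⟩, ⟨mem_univ _, hs₀⟩⟩
  set r := 2 * B / κ
  have hK : IsCompact ((Metric.closedBall (0 : Space N) r ×ˢ Icc 0 T) ×ˢ
      (Metric.closedBall (0 : Space N) (r + 2 * δ * (2 * B) + 1) ×ˢ Icc 0 T)) :=
    ((isCompact_closedBall _ _).prod isCompact_Icc).prod
      ((isCompact_closedBall _ _).prod isCompact_Icc)
  obtain ⟨z, hz, hmax⟩ := hcont.exists_isMaxOn'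
    ((isClosed_closedDomain N T).prod (isClosed_closedDomain N T)) hmem0 (by
    rw [eventually_inf_principal]
    filter_upwards [hK.compl_mem_cocompact] with z hz hzd
    by_contra! hlt
    apply hz
    have hpos : 0 ≤ Φ z := le_trans h0 hlt.le
    simp only [hΦ] at hpos
    have h1 := (abs_le.1 (hB z.1.1 z.1.2 hzd.1.2)).2
    have h2 := (abs_le.1 (hB z.2.1 z.2.2 hzd.2.2)).1
    have h3 := hg0 (z.1.2 - z.2.2)
    have h4 : 0 ≤ (2 * δ)⁻¹ * ‖z.1.1 - z.2.1‖ ^ 2 := by positivity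
    have h5 : ‖z.1.1‖ ≤ smoothDist 1 0 z.1.1 := by
      simpa using norm_le_smoothDist 1 0 z.1.1
    have h6 : κ * ‖z.1.1‖ ≤ κ * smoothDist 1 0 z.1.1 := by gcongr
    have h7 : 0 ≤ κ * ‖z.1.1‖ := by positivity
    have h8 : ‖z.1.1‖ ≤ r := by
      rw [le_div_iff₀ hκ]; linarith [mul_comm κ ‖z.1.1‖]
    have h9 : ‖z.1.1 - z.2.1‖ ^ 2 ≤ 2 * δ * (2 * B) := by
      rw [← inv_mul_le_iff₀ (by positivity)]; linarith
    have h10 : ‖z.2.1‖ ≤ ‖z.1.1‖ + ‖z.1.1 - z.2.1‖ := by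
      have := norm_sub_le z.1.1 (z.1.1 - z.2.1)
      simpa using this
    refine ⟨⟨by simpa using h8, hzd.1.2⟩, ⟨?_, hzd.2.2⟩⟩
    rw [mem_closedBall_zero_iff]
    nlinarith [sq_nonneg (‖z.1.1 - z.2.1‖ - 1), norm_nonneg (z.1.1 - z.2.1)])
  exact ⟨z.1.1, z.1.2, hz.1.2, z.2.1, z.2.2, hz.2.2, fun x' t' ht' y' s' hs' =>
    hmax (show (((x', t'), (y', s')) : (Space N × ℝ) × (Space N × ℝ)) ∈
      closedDomain N T ×ˢ closedDomain N T from ⟨⟨mem_univ _, ht'⟩, ⟨mem_univ _, hs'⟩⟩)⟩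

/-- Going back by a common lag and stopping at time `0` does not increase the time penalty. -/
theorem abs_max_sub_max_le (a b c : ℝ) : |max (a - c) 0 - max (b - c) 0| ≤ |a - b| := by
  have := abs_max_sub_max_le_abs (a - c) (b - c) 0
  simpa using this

theorem mul_sub_sq_le {L δ z : ℝ} (hδ : 0 < δ) : L * z - (2 * δ)⁻¹ * z ^ 2 ≤ L ^ 2 * δ / 2 := by
  have : L ^ 2 * δ / 2 - (L * z - (2 * δ)⁻¹ * z ^ 2) = (2 * δ)⁻¹ * (z - L * δ) ^ 2 := by
    field_simp; ring
  have h2 : 0 ≤ (2 * δ)⁻¹ * (z - L * δ) ^ 2 := by positivity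
  linarith

/-- The Caputo derivative of the regularised power is bounded below by a multiple of `log η`. -/
theorem caputo_smoothPow_ge {α M T : ℝ} (hα : 0 < α) (hα₁ : α < 1) (hM : 0 < M) :
    ∃ A : ℝ, 0 < A ∧ ∀ η s t : ℝ, 0 < η → η ≤ 1 → t ∈ Ioc 0 T →
      -(A * (1 + Real.log (1 / η))) ≤ caputoJ α (fun r => smoothPow α M η (r - s)) t +
        caputoK α 0 t (fun r => smoothPow α M η (r - s)) t := by
  obtain ⟨A, hA0, hA⟩ := caputo_ge_neg_log (T := T) hα hα₁ hM
  refine ⟨A, hA0, fun η s t hη hη1 ht => hA η _ t hη hη1 ht ?_ ?_ ?_⟩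
  · exact ((contDiff_smoothPow α M hη).continuous.comp (by fun_prop)).continuousOn
  · intro r hr
    have := smoothPow_sub_le_lipschitz hα hα₁ hM.le hη (t - s) (r - s)
    rwa [sub_sub_sub_cancel_right, abs_of_nonneg (sub_nonneg.2 hr.2)] at this
  · intro r hr
    have := smoothPow_sub_le_holder (η := η) hα hα₁ hM.le (t - s) (r - s)
    rwa [sub_sub_sub_cancel_right, abs_of_nonneg (sub_nonneg.2 hr.2)] at this

/-- Bounded viscosity solutions inherit their Hölder modulus in time from the initial time. -/
theorem IsViscositySolution.time_holder {T α ε : ℝ} (hT : 0 < T) (hα : 0 < α) (hα₁ : α < 1)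
    (hε : 0 < ε) {H : Space N → Space N → ℝ} (hH : Continuous (Function.uncurry H))
    (hcoer : Coercive H) (hper : Periodic H) {u₀ : Space N → ℝ} {u : Space N → ℝ → ℝ}
    (h : IsViscositySolution T α ε H u₀ u) (hb : IsBounded T u) {L C : ℝ} (hL : 0 < L)
    (hLip : ∀ x y, |u₀ x - u₀ y| ≤ L * ‖x - y‖) (hC : 0 < C)
    (hinit : ∀ x, ∀ t ∈ Icc 0 T, |u x t - u₀ x| ≤ C * t ^ α)
    (x : Space N) {t s : ℝ} (ht : t ∈ Icc 0 T) (hs : s ∈ Icc 0 T) :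
    u x t - u x s ≤ C * |t - s| ^ α := by
  by_contra! hlt
  obtain ⟨hu, hsub, hsup⟩ := h
  have hu0 : ∀ x, u x 0 = u₀ x := fun x => le_antisymm (hsub.2.1 x) (hsup.2.1 x)
  -- One third of the excess pays for `η`, one for `κ`, and one remains as the value of the maximum.
  obtain ⟨θ, hθ, hθ3⟩ : ∃ θ : ℝ, 0 < θ ∧ 3 * θ = u x t - u x s - C * |t - s| ^ α :=
    ⟨(u x t - u x s - C * |t - s| ^ α) / 3, by linarith, by ring⟩
  -- the regularisation parameter `η`
  obtain ⟨η, hη, hη1, hηθ⟩ := exists_rpow_le hα hC hθ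
  set G := smoothPow α C η with hGd
  have hGc : ContDiff ℝ 1 G := contDiff_smoothPow α C hη
  have hG0 : ∀ r, 0 ≤ G r := fun r => smoothPow_nonneg hC.le η r
  have hGts : G (t - s) ≤ C * |t - s| ^ α + θ := by
    have h1 := (abs_le.1 (smoothPow_sub_le_holder (η := η) hα hα₁ hC.le (t - s) 0)).2
    rw [smoothPow_zero hη.le, sub_zero] at h1
    linarith
  -- the gradient bound
  obtain ⟨A, hA0, hA⟩ := caputo_smoothPow_ge (T := T) hα hα₁ hC
  obtain ⟨R', hR'⟩ := hcoer.exists_radius (A * (1 + Real.log (1 / η)))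
  set R := max R' 0
  have hR0 : 0 ≤ R := le_max_right _ _
  have hR : ∀ y p, H y p ≤ A * (1 + Real.log (1 / η)) → ‖p‖ ≤ R := fun y p hp => by
    by_contra! hn
    exact absurd (hR' y p ((le_max_left _ _).trans hn.le)) (not_lt.2 hp)
  set c := α / Real.Gamma (1 - α) * (θ / 2 * (T ^ (-α) / α)) with hc
  have hc0 : 0 < c := by
    have := gammaFactor_pos hα hα₁
    positivity
  -- `R` and `c` involve neither `κ` nor `δ`, so both can now be chosen small relative to `d`.
  obtain ⟨d, hd, hunif⟩ := hper.uniform_continuity hH (R + 1) hc0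
  have hsdpos : 0 < smoothDist 1 0 x := smoothDist_pos one_pos 0 x
  obtain ⟨κ, hκ, hκ1, hκd, hκθ⟩ :
      ∃ κ : ℝ, 0 < κ ∧ κ ≤ 1 ∧ κ < d ∧ κ * smoothDist 1 0 x ≤ θ := by
    refine ⟨min (min 1 (d / 2)) (θ / smoothDist 1 0 x), by positivity,
      (min_le_left _ _).trans (min_le_left _ _), ?_, ?_⟩
    · exact ((min_le_left _ _).trans (min_le_right _ _)).trans_lt (by linarith)
    · rw [← le_div_iff₀ hsdpos]; exact min_le_right _ _
  obtain ⟨δ, hδ, hδL, hδd⟩ : ∃ δ : ℝ, 0 < δ ∧ L ^ 2 * δ ≤ θ ∧ ε⁻¹ * (δ * (R + 1)) < d := by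
    refine ⟨min (θ / L ^ 2) (d * ε / (2 * (R + 1))), by positivity, ?_, ?_⟩
    · rw [mul_comm, ← le_div_iff₀ (by positivity)]; exact min_le_left _ _
    · calc ε⁻¹ * (min (θ / L ^ 2) (d * ε / (2 * (R + 1))) * (R + 1))
          ≤ ε⁻¹ * (d * ε / (2 * (R + 1)) * (R + 1)) := by gcongr; exact min_le_right _ _
        _ = d / 2 := by field_simp
        _ < d := by linarith
  have hbase : θ ≤ u x t - u x s - G (t - s) - (2 * δ)⁻¹ * ‖x - x‖ ^ 2 - κ * smoothDist 1 0 x := by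
    simp only [sub_self, norm_zero]
    linarith
  obtain ⟨a, ta, hta, b, sb, hsb, hmax⟩ :=
    exists_max_doubled hu hb hGc.continuous hG0 hδ hκ ht hs (hθ.le.trans hbase)
  have hΦ := hbase.trans (hmax x t ht x s hs)
  have hκsd : ∀ z : Space N, 0 ≤ κ * smoothDist 1 0 z := fun z =>
    mul_nonneg hκ.le (smoothDist_pos one_pos 0 z).le
  have hquad : L * ‖a - b‖ - (2 * δ)⁻¹ * ‖a - b‖ ^ 2 ≤ θ / 2 := by
    have := mul_sub_sq_le (L := L) (z := ‖a - b‖) hδ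
    linarith
  have hLab := (abs_le.1 (hLip a b)).2
  -- At a zero time, `hinit` and the penalty `G` cancel. What is left is at most `L‖a - b‖` minus
  -- the quadratic term, hence at most `θ/2 < θ`.
  have hta0 : 0 < ta := by
    refine lt_of_le_of_ne hta.1 (fun h0 => ?_)
    have h1 := (abs_le.1 (hinit b sb hsb)).1
    have h2 := mul_rpow_le_smoothPow hα hC.le η (ta - sb)
    rw [← h0, zero_sub, abs_neg, abs_of_nonneg hsb.1] at h2
    rw [← h0, zero_sub, hu0] at hΦ
    linarith [hκsd a]
  have hsb0 : 0 < sb := by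
    refine lt_of_le_of_ne hsb.1 (fun h0 => ?_)
    have h1 := (abs_le.1 (hinit a ta hta)).2
    have h2 := mul_rpow_le_smoothPow hα hC.le η (ta - sb)
    rw [← h0, sub_zero, abs_of_nonneg hta.1] at h2
    rw [← h0, sub_zero, hu0] at hΦ
    linarith [hκsd a]
  -- the subsolution test
  set p : Space N := (2 * δ)⁻¹ • ((2 : ℝ) • (a - b)) with hp
  set q : Space N := κ • ((smoothDist 1 0 a)⁻¹ • (a - 0)) with hq
  have hqκ : ‖q‖ ≤ κ := by
    rw [hq, norm_smul, Real.norm_of_nonneg hκ.le]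
    nlinarith [norm_gradient_smoothDist_le one_pos 0 a]
  have hψ₁ : ContDiff ℝ 1 (fun z : Space N => (2 * δ)⁻¹ * ‖z - b‖ ^ 2 + κ * smoothDist 1 0 z) :=
    (contDiff_const.mul ((contDiff_id.sub contDiff_const).norm_sq ℝ)).add
      (contDiff_const.mul (contDiff_smoothDist one_pos 0))
  have hg₁ : ContDiff ℝ 1 (fun r => G (r - sb)) := hGc.comp (contDiff_id.sub contDiff_const)
  have hgrad₁ : HasGradientAt (fun z : Space N => (2 * δ)⁻¹ * ‖z - b‖ ^ 2 + κ * smoothDist 1 0 z)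
      (p + q) a :=
    hasGradientAt_add (hasGradientAt_const_mul (hasGradientAt_norm_sq_sub b a) _)
      (hasGradientAt_const_mul (hasGradientAt_smoothDist one_pos 0 a) _)
  have hmax₁ : ∀ y, ∀ r ∈ Icc 0 T,
      u y r - ((2 * δ)⁻¹ * ‖y - b‖ ^ 2 + κ * smoothDist 1 0 y) - G (r - sb)
        ≤ u a ta - ((2 * δ)⁻¹ * ‖a - b‖ ^ 2 + κ * smoothDist 1 0 a) - G (ta - sb) := fun y r hr => by
    linarith [hmax y r hr b sb hsb]
  have hpq : ‖p + q‖ ≤ R := by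
    have h1 := hsub.test_separable hψ₁ hg₁.contDiffOn hg₁.continuous.continuousOn hgrad₁
      ⟨hta0, hta.2⟩ hmax₁
    have h2 := hA η sb ta hη hη1 ⟨hta0, hta.2⟩
    exact hR (ε⁻¹ • a) _ (by linarith)
  have hpR : ‖p‖ ≤ R + 1 := by
    have : p = (p + q) - q := by abel
    rw [this]
    linarith [norm_sub_le (p + q) q]
  obtain ⟨C₁, hC₁⟩ := hsub.memory_le hα hα₁ hu hψ₁ hg₁ hgrad₁ ⟨hta0, hta.2⟩ hmax₁
  -- the supersolution test
  have hψ₂ : ContDiff ℝ 1 (fun z : Space N => (2 * δ)⁻¹ * ‖z - a‖ ^ 2) :=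
    contDiff_const.mul ((contDiff_id.sub contDiff_const).norm_sq ℝ)
  have hg₂ : ContDiff ℝ 1 (fun r => G (ta - r)) := hGc.comp (contDiff_const.sub contDiff_id)
  have hgrad₂ : HasGradientAt (fun z : Space N => (2 * δ)⁻¹ * ‖z - a‖ ^ 2) (-p) b := by
    have := hasGradientAt_const_mul (hasGradientAt_norm_sq_sub a b) (2 * δ)⁻¹
    rwa [← neg_sub a b, smul_neg, smul_neg] at this
  obtain ⟨C₂, hC₂⟩ := hsup.neg.memory_le hα hα₁ hu.neg hψ₂ hg₂ hgrad₂ ⟨hsb0, hsb.2⟩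
    (fun y r hr => by
      have := hmax a ta hta y r hr
      rw [norm_sub_rev b a, norm_sub_rev y a]
      linarith)
  -- comparison of the two histories
  have hcx : ∀ z : Space N, ∀ r ∈ Icc 0 T, ContinuousOn (u z) (Icc 0 r) := fun z r hr =>
    hu.comp (f := fun s : ℝ => ((z, s) : Space N × ℝ)) (by fun_prop)
      (fun s hs => ⟨mem_univ _, hs.1, hs.2.trans hr.2⟩)
  -- Both points are moved back by the same lag, with `a` and `b` fixed; only `G` changes among the
  -- penalties, and it does not grow.
  have hhist : ∀ τ, 0 < τ →
      u b sb - u b (max (sb - τ) 0) ≤ u a ta - u a (max (ta - τ) 0) := fun τ hτ => by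
    have h1 := hmax a (max (ta - τ) 0) ⟨le_max_right _ _, max_le (by linarith [hta.2]) hT.le⟩
      b (max (sb - τ) 0) ⟨le_max_right _ _, max_le (by linarith [hsb.2]) hT.le⟩
    have h2 : G (max (ta - τ) 0 - max (sb - τ) 0) ≤ G (ta - sb) :=
      smoothPow_mono hα hC.le η (abs_max_sub_max_le ta sb τ)
    linarith
  have hstart : θ / 2 ≤ (u a ta - u a 0) - (u b sb - u b 0) := by
    rw [hu0, hu0]
    linarith [hκsd a, hG0 (ta - sb)]
  have hbound : ∀ ρ ∈ Ioo 0 (min ta sb),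
      c + H (ε⁻¹ • a) (p + q) - H (ε⁻¹ • b) p ≤ (C₁ + C₂) * ρ ^ (1 - α) := fun ρ hρ => by
    have hρa : ρ < ta := hρ.2.trans_le (min_le_left _ _)
    have hρb : ρ < sb := hρ.2.trans_le (min_le_right _ _)
    have h1 := hC₁ ρ ⟨hρ.1, hρa⟩
    have h2 := hC₂ ρ ⟨hρ.1, hρb⟩
    rw [memory_neg, neg_neg] at h2
    have h3 := memory_sub_ge hα hα₁ hT hta hsb hρ.1 (hρa.le.trans hta.2) (hcx a ta hta)
      (hcx b sb hsb) hhist hstart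
    rw [← hc] at h3
    linarith
  have hlim : Tendsto (fun ρ : ℝ => (C₁ + C₂) * ρ ^ (1 - α)) (𝓝[>] 0) (𝓝 0) := by
    have : Continuous (fun ρ : ℝ => (C₁ + C₂) * ρ ^ (1 - α)) :=
      continuous_const.mul (Real.continuous_rpow_const (by linarith))
    have h1 := (this.tendsto 0).mono_left (nhdsWithin_le_nhds (s := Ioi 0))
    simpa [Real.zero_rpow (show (1 - α) ≠ 0 by linarith)] using h1
  have hfinal : c + H (ε⁻¹ • a) (p + q) - H (ε⁻¹ • b) p ≤ 0 := by
    refine ge_of_tendsto hlim ?_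
    filter_upwards [Ioo_mem_nhdsGT (lt_min hta0 hsb0)] with ρ hρ using hbound ρ hρ
  have hdist : ‖ε⁻¹ • a - ε⁻¹ • b‖ < d := by
    rw [← smul_sub, norm_smul, Real.norm_of_nonneg (by positivity)]
    -- As `‖p‖ ≤ R + 1` uniformly in `δ`, the points satisfy `‖a - b‖ ≤ δ(R + 1)`, which `hδd` makes
    -- small even after division by `ε`.
    have h1 : a - b = δ • p := by
      rw [hp, smul_smul, smul_smul]
      have : δ * (2 * δ)⁻¹ * 2 = 1 := by field_simp
      rw [this, one_smul]
    rw [h1, norm_smul, Real.norm_of_nonneg hδ.le]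
    refine lt_of_le_of_lt ?_ hδd
    gcongr
  have hHd := hunif (ε⁻¹ • a) (ε⁻¹ • b) (p + q) p (by linarith) hpR hdist (by
    rw [add_sub_cancel_left]; linarith)
  linarith [(abs_lt.1 hHd).1]

/-! ### Continuity in space, uniformly in the oscillation scale -/

/-- A cone of slope `2R` with vertex `y`, plus the regularised power in time, is tested from above.
At a maximum with positive time the equation forces a gradient shorter than `R`, which a cone of
slope `2R` has only near its smoothed vertex. The Hölder bound in time then compares the value there
with `u y t`. -/
theorem IsViscositySolution.space_modulus {T α ε : ℝ} (hT : 0 < T) (hα : 0 < α) (hα₁ : α < 1)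
    (hε : 0 < ε) {H : Space N → Space N → ℝ} (hH : Continuous (Function.uncurry H))
    (hcoer : Coercive H) (hper : Periodic H) {u₀ : Space N → ℝ} {u : Space N → ℝ → ℝ}
    (h : IsViscositySolution T α ε H u₀ u) (hb : IsBounded T u) {L C : ℝ} (hL : 0 < L)
    (hLip : ∀ x y, |u₀ x - u₀ y| ≤ L * ‖x - y‖) (hC : 0 < C)
    (hinit : ∀ x, ∀ t ∈ Icc 0 T, |u x t - u₀ x| ≤ C * t ^ α) {η A R : ℝ} (hη : 0 < η)
    (hA : ∀ s t : ℝ, t ∈ Ioc 0 T → -A ≤ caputoJ α (fun r => smoothPow α C η (r - s)) t +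
        caputoK α 0 t (fun r => smoothPow α C η (r - s)) t)
    (hLR : L ≤ R) (hR : ∀ y p, R ≤ ‖p‖ → A < H y p)
    (x y : Space N) {t : ℝ} (ht : t ∈ Icc 0 T) :
    u x t - u y t ≤ 2 * R * ‖x - y‖ + C * η ^ α := by
  have hR0 : 0 < R := hL.trans_le hLR
  obtain ⟨hu, hsub, -⟩ := id h
  apply le_of_forall_pos_le_add
  intro e he
  have hcx : Continuous (fun z => u z t) :=
    hu.comp_continuous (f := fun z : Space N => ((z, t) : Space N × ℝ)) (by fun_prop)
      (fun z => ⟨mem_univ _, ht⟩)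
  obtain ⟨r, hr, hcr⟩ := Metric.continuous_iff.1 hcx y (e / 2) (by positivity)
  obtain ⟨σ, hσ, hσr, hσe⟩ : ∃ σ : ℝ, 0 < σ ∧ σ ≤ r ∧ 2 * R * σ ≤ e / 2 := by
    refine ⟨min r (e / (4 * R)), by positivity, min_le_left _ _, ?_⟩
    calc 2 * R * min r (e / (4 * R)) ≤ 2 * R * (e / (4 * R)) := by
          gcongr; exact min_le_right _ _
      _ = e / 2 := by field_simp; norm_num
  have hψ : ContDiff ℝ 1 (fun z => 2 * R * smoothDist σ y z) :=
    contDiff_const.mul (contDiff_smoothDist hσ y)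
  have hg : ContDiff ℝ 1 (fun s => smoothPow α C η (s - t)) :=
    (contDiff_smoothPow α C hη).comp (contDiff_id.sub contDiff_const)
  have hψle : ∀ z, 2 * R * ‖z - y‖ ≤ 2 * R * smoothDist σ y z := fun z => by
    gcongr; exact norm_le_smoothDist σ y z
  obtain ⟨a, s, hs, hmax⟩ := exists_max_separable hT hu hb hψ.continuous hg.continuous.continuousOn
    (a := y) (show 0 < 2 * R by positivity) hψle
  have hge := mul_rpow_le_smoothPow hα hC.le η (s - t)
  have hval : u a s - 2 * R * smoothDist σ y a - smoothPow α C η (s - t) ≤ u y t + e / 2 := by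
    rcases hs.1.eq_or_lt with h0 | hs0
    · have h1 := hsub.2.1 a
      have h2 := (abs_le.1 (hLip a y)).2
      have h3 := (abs_le.1 (hinit y t ht)).1
      have h4 : L * ‖a - y‖ ≤ 2 * R * ‖a - y‖ := by gcongr; linarith
      rw [← h0, zero_sub, abs_neg, abs_of_nonneg ht.1] at hge
      rw [← h0, zero_sub]
      linarith [hψle a]
    · have hgrad := hasGradientAt_const_mul (hasGradientAt_smoothDist hσ y a) (2 * R)
      have h1 := hsub.test_separable hψ hg.contDiffOn hg.continuous.continuousOn hgrad
        ⟨hs0, hs.2⟩ hmax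
      have h2 := hA t s ⟨hs0, hs.2⟩
      have h3 : ‖(2 * R) • ((smoothDist σ y a)⁻¹ • (a - y))‖ < R := by
        by_contra! hn
        linarith [hR (ε⁻¹ • a) _ hn]
      have hD := smoothDist_pos hσ y a
      rw [norm_smul, norm_smul, norm_inv, Real.norm_of_nonneg hD.le,
        Real.norm_of_nonneg (by positivity : (0 : ℝ) ≤ 2 * R)] at h3
      -- Together with `smoothDist_le` this yields `‖a - y‖ < σ`.
      have h4 : 2 * ‖a - y‖ < smoothDist σ y a := by
        have : 2 * R * ((smoothDist σ y a)⁻¹ * ‖a - y‖)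
            = R * (2 * ‖a - y‖ / smoothDist σ y a) := by field_simp
        rw [this] at h3
        have h5 : 2 * ‖a - y‖ / smoothDist σ y a < 1 := by nlinarith
        rwa [div_lt_one hD] at h5
      have h6 : ‖a - y‖ < r := by linarith [smoothDist_le hσ y a]
      have h7 := (abs_lt.1 (hcr a (by rwa [dist_eq_norm]))).2
      have h8 := h.time_holder hT hα hα₁ hε hH hcoer hper hb hL hLip hC hinit a hs ht
      have h9 : 0 ≤ 2 * R * smoothDist σ y a := by positivity
      linarith
  have hxt := hmax x t ht
  rw [sub_self, smoothPow_zero hη.le] at hxt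
  have h1 : 2 * R * smoothDist σ y x ≤ 2 * R * (‖x - y‖ + σ) := by
    gcongr; exact smoothDist_le hσ y x
  linarith

theorem LipBUC.exists_lipschitz {u₀ : Space N → ℝ} (h : LipBUC u₀) :
    ∃ L : ℝ, 0 < L ∧ ∀ x y, |u₀ x - u₀ y| ≤ L * ‖x - y‖ := by
  obtain ⟨⟨K, hK⟩, -⟩ := h
  refine ⟨K + 1, by positivity, fun x y => ?_⟩
  have := hK.dist_le_mul x y
  rw [Real.dist_eq, dist_eq_norm] at this
  nlinarith [norm_nonneg (x - y)]

/-- The estimates for bounded viscosity solutions, with constants independent of `ε`. -/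
theorem exists_uniform_estimates {T α : ℝ} (hT : 0 < T) (hα : 0 < α) (hα₁ : α < 1)
    {H : Space N → Space N → ℝ} (hH : Continuous (Function.uncurry H))
    (hcoer : Coercive H) (hper : Periodic H) {u₀ : Space N → ℝ} (hu₀ : LipBUC u₀) :
    ∃ L C A : ℝ, 0 < L ∧ 0 < C ∧ 0 < A ∧ ∀ ε : ℝ, 0 < ε → ∀ u : Space N → ℝ → ℝ,
      IsViscositySolution T α ε H u₀ u → IsBounded T u →
        (∀ x, ∀ t ∈ Icc 0 T, |u x t - u₀ x| ≤ C * t ^ α) ∧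
        ∀ η R : ℝ, 0 < η → η ≤ 1 → L ≤ R →
          (∀ y p, R ≤ ‖p‖ → A * (1 + Real.log (1 / η)) < H y p) →
          ∀ x y, ∀ t ∈ Icc 0 T, |u x t - u y t| ≤ 2 * R * ‖x - y‖ + C * η ^ α := by
  obtain ⟨L, hL, hLip⟩ := hu₀.exists_lipschitz
  obtain ⟨A₀, hA₀, hHA⟩ := hper.exists_bound hH L
  have hΓ : 0 < Real.Gamma (1 - α) := Real.Gamma_pos_of_pos (by linarith)
  set C := Real.Gamma (1 - α) * (A₀ + 1)
  have hC : 0 < C := by positivity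
  have hCA : A₀ < C / Real.Gamma (1 - α) := by
    rw [mul_div_cancel_left₀ _ hΓ.ne']; linarith
  obtain ⟨A, hA, hAc⟩ := caputo_smoothPow_ge (T := T) hα hα₁ hC
  refine ⟨L, C, A, hL, hC, hA, fun ε hε u h hb => ?_⟩
  have hinit : ∀ x, ∀ t ∈ Icc 0 T, |u x t - u₀ x| ≤ C * t ^ α := by
    intro x t ht
    have h1 := h.2.1.initial_bound hT hα hα₁ h.1 hb hL hLip
      (fun x p hp => (abs_le.1 (hHA x p hp)).1) hC hCA x ht
    obtain ⟨B, hB⟩ := hb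
    have h2 := h.2.2.neg.initial_bound hT hα hα₁ h.1.neg
      ⟨B, fun x t ht => by rw [abs_neg]; exact hB x t ht⟩ hL
      (fun x y => by rw [neg_sub_neg, abs_sub_comm]; exact hLip x y)
      (fun x p hp => neg_le_neg (abs_le.1 (hHA x (-p) (by rwa [norm_neg]))).2) hC hCA x ht
    rw [abs_le]
    constructor <;> linarith
  refine ⟨hinit, fun η R hη hη1 hLR hR x y t ht => ?_⟩
  have key : ∀ x y, u x t - u y t ≤ 2 * R * ‖x - y‖ + C * η ^ α := fun x y =>
    h.space_modulus hT hα hα₁ hε hH hcoer hper hb hL hLip hC hinit hη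
      (fun s t ht => hAc η s t hη hη1 ht) hLR hR x y ht
  rw [abs_le]
  have h2 := key y x
  rw [norm_sub_rev] at h2
  exact ⟨by linarith, key x y⟩

/-! ### From the family of estimates to moduli -/

/-- Nonnegative coefficients give `ω r ≤ max 1 (r/s) · ω s`; used in both directions this squeezes
`ω` at positive points. At `0` the small `b i` take over. -/
theorem isModulus_iInf_affine {ι : Type*} [Nonempty ι] {a b : ι → ℝ} (ha : ∀ i, 0 ≤ a i)
    (hb : ∀ i, 0 ≤ b i) (h : ∀ e, 0 < e → ∃ i, b i ≤ e) :
    IsModulus (fun r => ⨅ i, (a i * r + b i)) := by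
  set ω : ℝ → ℝ := fun r => ⨅ i, (a i * r + b i) with hω
  have hbdd : ∀ r, 0 ≤ r → BddBelow (range fun i => a i * r + b i) := fun r hr =>
    ⟨0, by rintro _ ⟨i, rfl⟩; have := ha i; have := hb i; positivity⟩
  have hle : ∀ r, 0 ≤ r → ∀ i, ω r ≤ a i * r + b i := fun r hr i => ciInf_le (hbdd r hr) i
  have h0 : ∀ r, 0 ≤ r → 0 ≤ ω r := fun r hr => le_ciInf fun i => by
    have := ha i; have := hb i; positivity
  have hscale : ∀ r s, 0 ≤ r → 0 < s → ω r ≤ max 1 (r / s) * ω s := by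
    intro r s hr hs
    have hm : (1 : ℝ) ≤ max 1 (r / s) := le_max_left _ _
    have hm0 : 0 < max 1 (r / s) := by linarith
    rw [mul_comm, ← div_le_iff₀ hm0]
    refine le_ciInf fun i => ?_
    rw [div_le_iff₀ hm0]
    refine (hle r hr i).trans ?_
    have h1 : r ≤ s * max 1 (r / s) := by
      rw [mul_comm, ← div_le_iff₀ hs]; exact le_max_right _ _
    nlinarith [mul_le_mul_of_nonneg_left h1 (ha i), mul_le_mul_of_nonneg_left hm (hb i)]
  refine ⟨?_, ?_, ?_⟩
  · intro r hr
    rcases (mem_Ici.1 hr).eq_or_lt with h' | hr0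
    · subst h'
      have hω0 : ω 0 = 0 := le_antisymm (le_of_forall_pos_le_add fun e he => by
        obtain ⟨i, hi⟩ := h e he
        have := hle 0 le_rfl i
        linarith) (h0 0 le_rfl)
      rw [ContinuousWithinAt, hω0, Metric.tendsto_nhdsWithin_nhds]
      intro e he
      obtain ⟨i, hi⟩ := h (e / 2) (by positivity)
      have hai := ha i
      refine ⟨e / (2 * (a i + 1)), by positivity, fun z hz hzd => ?_⟩
      have hz0 : 0 ≤ z := hz
      rw [Real.dist_eq, sub_zero, abs_of_nonneg hz0] at hzd
      rw [Real.dist_eq, sub_zero, abs_of_nonneg (h0 z hz0)]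
      have h1 := hle z hz0 i
      rw [lt_div_iff₀ (by positivity)] at hzd
      nlinarith
    · apply ContinuousAt.continuousWithinAt
      have hup : Tendsto (fun z => max 1 (z / r) * ω r) (𝓝 r) (𝓝 (ω r)) := by
        have : Continuous (fun z : ℝ => max 1 (z / r) * ω r) := by fun_prop
        have h1 := this.tendsto r
        rwa [div_self hr0.ne', max_self, one_mul] at h1
      have hlo : Tendsto (fun z => ω r / max 1 (r / z)) (𝓝 r) (𝓝 (ω r)) := by
        have : ContinuousAt (fun z : ℝ => ω r / max 1 (r / z)) r := by
          apply ContinuousAt.div continuousAt_const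
          · exact continuousAt_const.max (continuousAt_const.div continuousAt_id hr0.ne')
          · exact (lt_of_lt_of_le one_pos (le_max_left _ _)).ne'
        have h1 := this.tendsto
        rwa [div_self hr0.ne', max_self, div_one] at h1
      refine tendsto_of_tendsto_of_tendsto_of_le_of_le' hlo hup ?_ ?_
      · filter_upwards [lt_mem_nhds hr0] with z hz
        rw [div_le_iff₀ (lt_of_lt_of_le one_pos (le_max_left _ _)), mul_comm]
        exact hscale r z hr0.le hz
      · filter_upwards [lt_mem_nhds hr0] with z hz using hscale z r hz.le hr0
  · intro r hr s hs hrs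
    refine le_ciInf fun i => (hle r hr i).trans ?_
    have := ha i
    gcongr
  · refine le_antisymm (le_of_forall_pos_le_add fun e he => ?_) (h0 0 le_rfl)
    obtain ⟨i, hi⟩ := h e he
    have := hle 0 le_rfl i
    linarith

theorem one_add_log_mul_le_rpow {r ν : ℝ} (hr : 0 < r) (hr1 : r ≤ 1) (hν₁ : ν < 1) :
    (1 + |Real.log r|) * r ≤ (1 + 1 / (1 - ν)) * r ^ ν := by
  have hp := Real.rpow_pos_of_pos hr (1 - ν)
  have h1 := (Real.abs_log_mul_self_rpow_lt r (1 - ν) hr hr1 (by linarith)).le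
  rw [abs_mul, abs_of_nonneg hp.le] at h1
  have h2 : r ^ (1 - ν) ≤ 1 := Real.rpow_le_one hr.le hr1 (by linarith)
  have e : r = r ^ (1 - ν) * r ^ ν := by rw [← Real.rpow_add hr]; simp
  calc (1 + |Real.log r|) * r = (r ^ (1 - ν) + |Real.log r| * r ^ (1 - ν)) * r ^ ν := by
        linear_combination (1 + |Real.log r|) * e
    _ ≤ _ := by gcongr

end

end TFHJ

theorem proposition3p3 (N : ℕ) (T α : ℝ) (hT : 0 < T) (hα₀ : 0 < α) (hα₁ : α < 1)
    (H : TFHJ.Space N → TFHJ.Space N → ℝ) (u₀ : TFHJ.Space N → ℝ)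
    (hH : Continuous (Function.uncurry H))
    (hA1 : TFHJ.Coercive H) (hA2 : TFHJ.Periodic H) (hA3 : TFHJ.LipBUC u₀) :
    (∃ ω : ℝ → ℝ, TFHJ.IsModulus ω ∧
      ∀ ε : ℝ, 0 < ε → ∀ u : TFHJ.Space N → ℝ → ℝ,
        TFHJ.IsViscositySolution T α ε H u₀ u → TFHJ.IsBounded T u →
        ∀ (x y : TFHJ.Space N), ∀ t ∈ Set.Icc 0 T, |u x t - u y t| ≤ ω ‖x - y‖) ∧
    (TFHJ.LinearGrowth H →
      (∃ C : ℝ, 0 < C ∧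
        ∀ ε : ℝ, 0 < ε → ∀ u : TFHJ.Space N → ℝ → ℝ,
          TFHJ.IsViscositySolution T α ε H u₀ u → TFHJ.IsBounded T u →
          ∀ (x y : TFHJ.Space N), ∀ t ∈ Set.Icc 0 T,
            |u x t - u y t| ≤ C * (1 + |Real.log ‖x - y‖|) * ‖x - y‖) ∧
      ∀ ν : ℝ, 0 < ν → ν < 1 →
        ∃ C : ℝ, 0 < C ∧
          ∀ ε : ℝ, 0 < ε → ∀ u : TFHJ.Space N → ℝ → ℝ,
            TFHJ.IsViscositySolution T α ε H u₀ u → TFHJ.IsBounded T u →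
            ∀ (x y : TFHJ.Space N), ∀ t ∈ Set.Icc 0 T,
              |u x t - u y t| ≤ C * ‖x - y‖ ^ ν) := by
  obtain ⟨L, C, A, hL, hC, hA, hest⟩ :=
    TFHJ.exists_uniform_estimates hT hα₀ hα₁ hH hA1 hA2 hA3
  refine ⟨?_, fun hlin => ?_⟩
  · have hR : ∀ η : Set.Ioc (0 : ℝ) 1, ∃ R : ℝ, L ≤ R ∧
        ∀ y p, R ≤ ‖p‖ → A * (1 + Real.log (1 / (η : ℝ))) < H y p := fun η => by
      obtain ⟨R, hR⟩ := hA1.exists_radius (A * (1 + Real.log (1 / (η : ℝ))))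
      exact ⟨max R L, le_max_right _ _, fun y p hp => hR y p ((le_max_left _ _).trans hp)⟩
    choose R hLR hR using hR
    have : Nonempty (Set.Ioc (0 : ℝ) 1) := ⟨⟨1, one_pos, le_rfl⟩⟩
    refine ⟨fun r => ⨅ η : Set.Ioc (0 : ℝ) 1, (2 * R η * r + C * (η : ℝ) ^ α),
      TFHJ.isModulus_iInf_affine (fun η => ?_) (fun η => ?_) (fun e he => ?_),
      fun ε hε u h hb x y t ht => le_ciInf fun η => ?_⟩
    · linarith [hLR η]
    · have := η.2.1; positivity
    · obtain ⟨η, h0, h1, h2⟩ := TFHJ.exists_rpow_le hα₀ hC he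
      exact ⟨⟨η, h0, h1⟩, h2⟩
    · exact (hest ε hε u h hb).2 η (R η) η.2.1 η.2.2 (hLR η) (hR η) x y t ht
  · obtain ⟨c, hc, hgrow⟩ := hlin
    set K := 2 * (c * (A * (1 + 1 / α) + c + 1) + L) + C with hK
    have hK0 : 0 < K := by positivity
    have hlog : ∀ ε : ℝ, 0 < ε → ∀ u : TFHJ.Space N → ℝ → ℝ,
        TFHJ.IsViscositySolution T α ε H u₀ u → TFHJ.IsBounded T u →
        ∀ (x y : TFHJ.Space N), ∀ t ∈ Set.Icc 0 T,
          |u x t - u y t| ≤ K * (1 + |Real.log ‖x - y‖|) * ‖x - y‖ := by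
      intro ε hε u h hb x y t ht
      rcases (norm_nonneg (x - y)).eq_or_lt with h0 | hr
      · rw [← h0, mul_zero, sub_eq_zero.1 (norm_eq_zero.1 h0.symm), sub_self, abs_zero]
      set r := ‖x - y‖
      set l := |Real.log r| with hl
      have hl0 : 0 ≤ l := abs_nonneg _
      have hm : 0 < min r 1 := by positivity
      -- Chosen so that `C η^α ≤ C r` while `log(1/η)` stays below `l/α`.
      set η := min r 1 ^ (1 / α) with hη
      have hη0 : 0 < η := by positivity
      have hη1 : η ≤ 1 := Real.rpow_le_one hm.le (min_le_right _ _) (by positivity)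
      have hηα : η ^ α = min r 1 := by
        rw [hη, ← Real.rpow_mul hm.le, one_div_mul_cancel hα₀.ne', Real.rpow_one]
      have hlogη : Real.log (1 / η) ≤ 1 / α * l := by
        rw [one_div, Real.log_inv, hη, Real.log_rpow hm, ← mul_neg]
        gcongr
        rcases le_total r 1 with h1 | h1
        · rw [min_eq_left h1]; exact neg_le_abs _
        · rw [min_eq_right h1, Real.log_one, neg_zero]; exact hl0
      have hα' : 0 < 1 / α := by positivity
      -- Linear growth solved for `‖p‖`: beyond `R` the Hamiltonian is at least `A(1 + l/α) + 1`.
      -- The summand `L` secures `L ≤ R`.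
      set R := c * (A * (1 + 1 / α * l) + c + 1) + L with hR
      have hLR : L ≤ R := by
        have : 0 ≤ c * (A * (1 + 1 / α * l) + c + 1) := by positivity
        linarith
      have hest' := (hest ε hε u h hb).2 η R hη0 hη1 hLR (fun y p hp => by
        have h1 := hgrow y p
        have h2 : A * (1 + Real.log (1 / η)) ≤ A * (1 + 1 / α * l) := by gcongr
        have h3 : c⁻¹ * (c * (A * (1 + 1 / α * l) + c + 1)) ≤ c⁻¹ * ‖p‖ := by
          gcongr; linarith
        rw [inv_mul_cancel_left₀ hc.ne'] at h3
        linarith) x y t ht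
      refine hest'.trans ?_
      rw [hηα]
      have h1 : C * min r 1 ≤ C * r := by gcongr; exact min_le_left _ _
      have h2 : 2 * R + C ≤ K * (1 + l) := by
        have : K * (1 + l) - (2 * R + C)
            = 2 * (c * (A * (1 / α) + (A + c + 1) * l) + L * l) + C * l := by
          rw [hK, hR]; ring
        have h3 : 0 ≤ 2 * (c * (A * (1 / α) + (A + c + 1) * l) + L * l) + C * l := by positivity
        linarith
      nlinarith
    refine ⟨⟨K, hK0, hlog⟩, fun ν hν₀ hν₁ => ?_⟩
    obtain ⟨-, -, B, hB⟩ := hA3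
    have hB0 : 0 ≤ B := (abs_nonneg _).trans (hB 0)
    have h1ν : 0 < 1 - ν := by linarith
    have hTα : 0 < T ^ α := Real.rpow_pos_of_pos hT α
    refine ⟨K * (1 + 1 / (1 - ν)) + 2 * (B + C * T ^ α), by positivity,
      fun ε hε u h hb x y t ht => ?_⟩
    rcases (norm_nonneg (x - y)).eq_or_lt with h0 | hr
    · rw [← h0, Real.zero_rpow hν₀.ne', mul_zero, sub_eq_zero.1 (norm_eq_zero.1 h0.symm),
        sub_self, abs_zero]
    have hp := Real.rpow_pos_of_pos hr ν
    rw [add_mul]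
    rcases le_total ‖x - y‖ 1 with h1 | h1
    · have h2 := hlog ε hε u h hb x y t ht
      have h3 := mul_le_mul_of_nonneg_left (TFHJ.one_add_log_mul_le_rpow hr h1 hν₁) hK0.le
      have h4 : 0 ≤ 2 * (B + C * T ^ α) * ‖x - y‖ ^ ν := by positivity
      linarith
    -- At large distances `r log r` is not controlled by `r^ν`; the initial bound supplies a sup
    -- bound independent of `ε` instead.
    · have hbd : ∀ z, |u z t| ≤ B + C * T ^ α := fun z => by
        have h2 := (hest ε hε u h hb).1 z t ht
        have h3 : t ^ α ≤ T ^ α := Real.rpow_le_rpow ht.1 ht.2 hα₀.le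
        have h4 : C * t ^ α ≤ C * T ^ α := by gcongr
        have h5 := abs_add_le (u z t - u₀ z) (u₀ z)
        rw [sub_add_cancel] at h5
        linarith [hB z]
      have h2 : |u x t - u y t| ≤ 2 * (B + C * T ^ α) := by
        linarith [abs_sub (u x t) (u y t), hbd x, hbd y]
      have h3 : 1 ≤ ‖x - y‖ ^ ν := Real.one_le_rpow h1 hν₀.le
      have h4 : 2 * (B + C * T ^ α) * 1 ≤ 2 * (B + C * T ^ α) * ‖x - y‖ ^ ν := by gcongr
      have h5 : 0 ≤ K * (1 + 1 / (1 - ν)) * ‖x - y‖ ^ ν := by positivity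
      linarith
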